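/- **Setting.** Let $p>q\ge 0$ be integers, $A(\lambda)=I_d\lambda^p+A_1\lambda^{p-1}+\dots+A_p$ and $B(\lambda)=B_0\lambda^q+\dots+B_q$ with $A_j\in\mathbb R^{d\times d}$, $B_j\in\mathbb R^{d\times m}$, and assume that $A(\lambda)$ and $B(\lambda)$ are left coprime (as matrices over $\mathbb C[\lambda]$). Write $\sigma(A(\cdot))=\{\lambda\in\mathbb C:\det A(\lambda)=0\}$, and let $\sigma(R)$ be the spectrum of a matrix $R$. Assume that $R_1,\dots,R_p\in\mathbb C^{d\times d}$ form a complete set of regular right solvents of $A(\lambda)$: for every $k$ one has $R_k^p+A_1R_k^{p-1}+\dots+A_p=0$ and $A(\lambda)=A^{(k)}(\lambda)(\lambda I_d-R_k)$ for a $\lambda$-matrix $A^{(k)}$ with $\sigma(R_k)\cap\sigma(A^{(k)}(\cdot))=\emptyset$, and $\sigma(A(\cdot))=\bigcup_{k=1}^p\sigma(R_k)$. Let $F(\lambda)=A(\lambda)^{-1}B(\lambda)$ and $$\operatorname{res}[F,R_k]=\frac1{2\pi i}\oint_{\Gamma_k}F(\lambda)\,d\lambda ,$$ where $\Gamma_k$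 is any positively oriented simple closed contour with $\sigma(R_k)$ in its interior and $\sigma(A(\cdot))\setminus\sigma(R_k)$ in its exterior. Let $L=(L(t))_{t\ge0}$ be an $\mathbb R^m$-valued Lévy process with $\mathbb E\|L(1)\|^2<\infty$ and $\mathbb E L(1)=0$, and put $\Sigma_L=\operatorname{Cov}(L(1))$. For complex random vectors, $\operatorname{Cov}(X,Z)=\mathbb E[(X-\mathbb EX)(Z-\mathbb EZ)^{\mathsf H}]$, where $^{\mathsf H}$ denotes the conjugate transpose. For matrices $S_1,\dots,S_p\in\mathbb C^{d\times d}$ let $V(S_1,\dots,S_p)\in\mathbb C^{pd\times pd}$ be the block Vandermonde matrix with blocks $S_k^{i}$ ($i=0,\dots,p-1$ indexing block rows, $k=1,\dots,p$ indexing block columns). Let $$Y(t)=\sum_{k=1}^pY_k(t),\qquad Y_k(t)=e^{R_kt}Y_k(0)+\int_0^te^{R_k(t-u)}\operatorname{res}[F,R_k]\,dL(u),\quad t\ge0,$$ with random vectors $Y_k(0)$ in $\mathbb C^d$ such that $V(R_1,\dots,R_p)[Y_1(0)^{\top},\dots,Y_p(0)^{\top}]^{\top}\in\mathbb R^{pd}$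 almost surely. Let $h>0$ be such that $V(e^{-hR_1},\dots,e^{-hR_p})$ is non-singular. Put $\Psi_0=I_d$, $$[\Psi_p,\dots,\Psi_1]=-[e^{-phR_1},\dots,e^{-phR_p}]\,V(e^{-hR_1},\dots,e^{-hR_p})^{-1},$$ $\Phi_j=-\Psi_p^{-1}\Psi_{p-j}$ for $j=1,\dots,p$, and $$U_n=Y(nh)-\sum_{j=1}^p\Phi_jY((n-j)h),\quad n\ge p .$$ **Proposition.** Let $N_{\nu,1}=\int_0^he^{R_\nu(h-u)}\operatorname{res}[F,R_\nu]\,dL(u)$ for $\nu=1,\dots,p$. The random vectors $U_n$ ($n\ge p$) and $N_{\nu,1}$ are square integrable, and for $\nu,\mu\in\{1,\dots,p\}$ $$\Sigma^{(h)}_{\nu,\mu}:=\operatorname{Cov}(N_{\nu,1},N_{\mu,1})=\int_0^he^{R_\nu u}\operatorname{res}[F,R_\nu]\,\Sigma_L\operatorname{res}[F,R_\mu]^{\mathsf H}e^{R_\mu^{\mathsf H}u}\,du .$$ For all $n\ge p$ and $l=0,\dots,p-1$, $$\operatorname{Cov}(U_{n+l},U_n)=\sum_{\nu=1}^p\sum_{r=0}^{p-l-1}\sum_{\mu=1}^p\Bigl(e^{h(r+l)R_\nu}-\sum_{j=1}^{r+l}\Phi_je^{h(r+l-j)R_\nu}\Bigr)\Sigma^{(h)}_{\nu,\mu}\Bigl(e^{hrR_\mu}-\sum_{j=1}^{r}\Phi_je^{h(r-j)R_\mu}\Bigr)^{\mathsf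 H},$$ and $\operatorname{Cov}(U_{n+l},U_n)=0_{d\times d}$ for all $n\ge p$ and $l\ge p$. -/

import Mathlib

open MeasureTheory ProbabilityTheory Filter Topology Polynomial
open scoped NNReal ENNReal

namespace MCARMA

noncomputable section

/-! ### Matrix polynomials -/

/-- Real matrices viewed as complex matrices. -/
def toC {d m : ℕ} (M : Matrix (Fin d) (Fin m) ℝ) : Matrix (Fin d) (Fin m) ℂ :=
  M.map (fun x : ℝ => (x : ℂ))

/-- The `λ`-matrix `A₀ λⁿ + A₁ λⁿ⁻¹ + ⋯ + Aₙ`, as a matrix over `ℂ[λ]`. Only the coefficients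
`A 0, …, A n` are used. -/
def lambdaMatrix {d m : ℕ} (n : ℕ) (A : ℕ → Matrix (Fin d) (Fin m) ℂ) :
    Matrix (Fin d) (Fin m) ℂ[X] :=
  ∑ k ∈ Finset.range (n + 1), (X ^ (n - k) : ℂ[X]) • (A k).map (fun z => (C z : ℂ[X]))

/-- The value `A(z) ∈ ℂ^{d × m}` of a `λ`-matrix at `z ∈ ℂ`. -/
def evalAt {d m : ℕ} (A : Matrix (Fin d) (Fin m) ℂ[X]) (z : ℂ) : Matrix (Fin d) (Fin m) ℂ :=
  A.map (fun q => q.eval z)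

/-- The spectrum `σ(A(·)) = {z | det A(z) = 0}` of a square `λ`-matrix. -/
def spec {d : ℕ} (A : Matrix (Fin d) (Fin d) ℂ[X]) : Set ℂ :=
  {z | (evalAt A z).det = 0}

/-- The spectrum `σ(R) = {z | det (z I - R) = 0}` of a complex matrix. -/
def matSpec {d : ℕ} (R : Matrix (Fin d) (Fin d) ℂ) : Set ℂ :=
  {z | (z • (1 : Matrix (Fin d) (Fin d) ℂ) - R).det = 0}

/-- `R` is a right solvent of the `λ`-matrix with coefficients `A 0, …, A p`:
`A₀ Rᵖ + A₁ Rᵖ⁻¹ + ⋯ + A_p = 0`. -/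
def IsRightSolvent {d : ℕ} (p : ℕ) (A : ℕ → Matrix (Fin d) (Fin d) ℂ)
    (R : Matrix (Fin d) (Fin d) ℂ) : Prop :=
  ∑ k ∈ Finset.range (p + 1), A k * R ^ (p - k) = 0

/-- A right solvent `R` is regular if `A(λ) = A⁽¹⁾(λ) (λ I - R)` with `σ(R) ∩ σ(A⁽¹⁾(·)) = ∅`.
(`Matrix.charmatrix R` is the `λ`-matrix `λ I - R`.) -/
def IsRegularRightSolvent {d : ℕ} (p : ℕ) (A : ℕ → Matrix (Fin d) (Fin d) ℂ)
    (R : Matrix (Fin d) (Fin d) ℂ) : Prop :=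
  IsRightSolvent p A R ∧
    ∃ A₁ : Matrix (Fin d) (Fin d) ℂ[X],
      lambdaMatrix p A = A₁ * Matrix.charmatrix R ∧ Disjoint (matSpec R) (spec A₁)

/-- `R 0, …, R (p - 1)` is a complete set of regular right solvents of the `λ`-matrix of degree `p`
with coefficients `A 0, …, A p`. -/
def IsCompleteRegularSet {d p : ℕ} (A : ℕ → Matrix (Fin d) (Fin d) ℂ)
    (R : Fin p → Matrix (Fin d) (Fin d) ℂ) : Prop :=
  (∀ k, IsRegularRightSolvent p A (R k)) ∧ spec (lambdaMatrix p A) = ⋃ k, matSpec (R k)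

/-- Left coprimeness: every common left divisor is unimodular. -/
def LeftCoprime {d m : ℕ} (A : Matrix (Fin d) (Fin d) ℂ[X]) (B : Matrix (Fin d) (Fin m) ℂ[X]) :
    Prop :=
  ∀ (D A' : Matrix (Fin d) (Fin d) ℂ[X]) (B' : Matrix (Fin d) (Fin m) ℂ[X]),
    A = D * A' → B = D * B' → IsUnit D

/-! ### Residues at right solvents -/

/-- The entrywise contour integral `∮_Γ F(z) dz` along a curve `Γ : [0, 1] → ℂ`. -/
def contourIntegral {d m : ℕ} (F : ℂ → Matrix (Fin d) (Fin m) ℂ) (Γ : ℝ → ℂ) :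
    Matrix (Fin d) (Fin m) ℂ :=
  Matrix.of fun a b => ∫ t in (0 : ℝ)..1, F (Γ t) a b * deriv Γ t

/-- `Γ : [0, 1] → ℂ` is a simple closed contour: closed, without self-intersections, continuous,
and continuously differentiable with bounded derivative off a finite set of parameters (in
particular every piecewise `C¹` simple closed curve is allowed). -/
def IsSimpleClosedContour (Γ : ℝ → ℂ) : Prop :=
  ContinuousOn Γ (Set.Icc 0 1) ∧ Γ 0 = Γ 1 ∧ Set.InjOn Γ (Set.Ico 0 1) ∧
    ∃ (S : Finset ℝ) (K : ℝ), ∀ t ∈ Set.Ioo (0 : ℝ) 1, t ∉ S →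
      ContDiffAt ℝ 1 Γ t ∧ ‖deriv Γ t‖ ≤ K

/-- The winding number `(2πi)⁻¹ ∮_Γ (z - w)⁻¹ dz`. -/
def windingNumber (Γ : ℝ → ℂ) (w : ℂ) : ℂ :=
  (2 * Real.pi * Complex.I)⁻¹ * ∫ t in (0 : ℝ)..1, (Γ t - w)⁻¹ * deriv Γ t

/-- `w` lies in the interior of the positively oriented simple closed contour `Γ`. -/
def InsideContour (Γ : ℝ → ℂ) (w : ℂ) : Prop :=
  (∀ t ∈ Set.Icc (0 : ℝ) 1, Γ t ≠ w) ∧ windingNumber Γ w = 1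

/-- `w` lies in the exterior of the simple closed contour `Γ`. -/
def OutsideContour (Γ : ℝ → ℂ) (w : ℂ) : Prop :=
  (∀ t ∈ Set.Icc (0 : ℝ) 1, Γ t ≠ w) ∧ windingNumber Γ w = 0

/-- `Γ` is a (positively oriented) simple closed contour with `σ(R)` in its interior and
`σ(A(·)) \ σ(R)` in its exterior. -/
def IsResidueContour {d : ℕ} (A : Matrix (Fin d) (Fin d) ℂ[X]) (R : Matrix (Fin d) (Fin d) ℂ)
    (Γ : ℝ → ℂ) : Prop :=
  IsSimpleClosedContour Γ ∧ (∀ w ∈ matSpec R, InsideContour Γ w) ∧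
    ∀ w ∈ spec A \ matSpec R, OutsideContour Γ w

/-- The residue `(2πi)⁻¹ ∮_Γ A(z)⁻¹ B(z) dz` of `F = A⁻¹ B`, computed along the contour `Γ`. -/
def residue {d m : ℕ} (A : Matrix (Fin d) (Fin d) ℂ[X]) (B : Matrix (Fin d) (Fin m) ℂ[X])
    (Γ : ℝ → ℂ) : Matrix (Fin d) (Fin m) ℂ :=
  (2 * Real.pi * Complex.I : ℂ)⁻¹ • contourIntegral (fun z => (evalAt A z)⁻¹ * evalAt B z) Γ

/-! ### The autoregressive polynomial of the sampled process -/

/-- The matrix exponential `e^{tR}`. -/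
def mexp {d : ℕ} (t : ℝ) (R : Matrix (Fin d) (Fin d) ℂ) : Matrix (Fin d) (Fin d) ℂ :=
  NormedSpace.exp ((t : ℂ) • R)

/-- The block Vandermonde matrix `V(S₁, …, S_p)`, with block `S_k ^ i` in block row
`i = 0, …, p - 1` and block column `k`. -/
def blockVandermonde {d p : ℕ} (S : Fin p → Matrix (Fin d) (Fin d) ℂ) :
    Matrix (Fin p × Fin d) (Fin p × Fin d) ℂ :=
  Matrix.of fun x y => (S y.1 ^ (x.1 : ℕ)) x.2 y.2

/-- The block row `[S₁ᵖ, …, S_pᵖ]`. -/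
def powerRow {d p : ℕ} (S : Fin p → Matrix (Fin d) (Fin d) ℂ) :
    Matrix (Fin d) (Fin p × Fin d) ℂ :=
  Matrix.of fun a y => (S y.1 ^ p) a y.2

/-- The matrices `Ψ₀ = I` and `[Ψ_p, …, Ψ₁] = -[S₁ᵖ, …, S_pᵖ] V(S₁, …, S_p)⁻¹`; so `Ψ_j` is the
block of this row in (zero-based) block column `p - j`. -/
def psi {d p : ℕ} (S : Fin p → Matrix (Fin d) (Fin d) ℂ) (j : ℕ) : Matrix (Fin d) (Fin d) ℂ :=
  if j = 0 then 1
  else if hj : p - j < p then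
    Matrix.of fun a b => (-(powerRow S * (blockVandermonde S)⁻¹)) a (⟨p - j, hj⟩, b)
  else 0

/-- `Φ_j = -Ψ_p⁻¹ Ψ_{p-j}` for `j = 1, …, p`, with `S_k = e^{-h R_k}`. -/
def phi {d p : ℕ} (h : ℝ) (R : Fin p → Matrix (Fin d) (Fin d) ℂ) (j : ℕ) :
    Matrix (Fin d) (Fin d) ℂ :=
  -((psi (fun k => mexp (-h) (R k)) p)⁻¹ * psi (fun k => mexp (-h) (R k)) (p - j))

/-! ### Lévy processes, covariances and stochastic integrals -/

variable {Ω : Type*} [MeasurableSpace Ω]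

/-- An `ℝᵐ`-valued Lévy process on `[0, ∞)`: started at `0` almost surely, with independent and
stationary increments and (almost surely) càdlàg paths. -/
structure IsLevyProcess {m : ℕ} (P : Measure Ω) (L : ℝ≥0 → Ω → (Fin m → ℝ)) : Prop where
  measurable : ∀ t, Measurable (L t)
  zero : ∀ᵐ ω ∂P, L 0 ω = 0
  indep : HasIndepIncrements L P
  stationary : ∀ s t : ℝ≥0, IdentDistrib (fun ω => L (s + t) ω - L s ω) (L t) P P
  cadlag : ∀ᵐ ω ∂P, ∀ t : ℝ≥0, ContinuousWithinAt (fun s => L s ω) (Set.Ici t) t ∧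
    ∃ l, Tendsto (fun s => L s ω) (𝓝[<] t) (𝓝 l)

/-- `Cov(X, Y) = E[(X - E X)(Y - E Y)ᴴ]`. -/
def cov {d e : ℕ} (P : Measure Ω) (X : Ω → (Fin d → ℂ)) (Y : Ω → (Fin e → ℂ)) :
    Matrix (Fin d) (Fin e) ℂ :=
  Matrix.of fun a b =>
    ∫ ω, (X ω a - ∫ ω', X ω' a ∂P) * star (Y ω b - ∫ ω', Y ω' b ∂P) ∂P

/-- A partition `a = t₀ ≤ t₁ ≤ ⋯ ≤ t_N = b` of `[a, b]`. -/
structure Subdivision (a b : ℝ≥0) where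
  size : ℕ
  pt : ℕ → ℝ≥0
  mono : Monotone pt
  left : pt 0 = a
  right : pt size = b

/-- The mesh `max_i (t_{i+1} - t_i)`. -/
def Subdivision.mesh {a b : ℝ≥0} (π : Subdivision a b) : ℝ≥0 :=
  (Finset.range π.size).sup fun i => π.pt (i + 1) - π.pt i

/-- The Riemann sum `∑_i f(t_i) (L(t_{i+1}) - L(t_i))`. -/
def riemannSum {d m : ℕ} (L : ℝ≥0 → Ω → (Fin m → ℝ)) (f : ℝ → Matrix (Fin d) (Fin m) ℂ)
    {a b : ℝ≥0} (π : Subdivision a b) (ω : Ω) : Fin d → ℂ :=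
  ∑ i ∈ Finset.range π.size,
    (f (π.pt i)).mulVec fun c => ((L (π.pt (i + 1)) ω c - L (π.pt i) ω c : ℝ) : ℂ)

/-- `Z` is (a version of) the stochastic integral `∫_a^b f(u) dL(u)` of a continuous deterministic
function `f`: the limit in probability of the Riemann sums along every sequence of partitions
of `[a, b]` whose mesh tends to `0`. -/
def IsStochInt {d m : ℕ} (P : Measure Ω) (L : ℝ≥0 → Ω → (Fin m → ℝ))
    (f : ℝ → Matrix (Fin d) (Fin m) ℂ) (a b : ℝ≥0) (Z : Ω → (Fin d → ℂ)) : Prop :=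
  AEMeasurable Z P ∧ ∀ π : ℕ → Subdivision a b,
    Tendsto (fun n => (π n).mesh) atTop (𝓝 0) →
      TendstoInMeasure P (fun n => riemannSum L f (π n)) atTop Z

open Classical in
/-- The stochastic integral `∫_a^b f(u) dL(u)` (unique up to null sets). -/
def stochInt {d m : ℕ} (P : Measure Ω) (L : ℝ≥0 → Ω → (Fin m → ℝ))
    (f : ℝ → Matrix (Fin d) (Fin m) ℂ) (a b : ℝ≥0) : Ω → (Fin d → ℂ) :=
  if hZ : ∃ Z, IsStochInt P L f a b Z then hZ.choose else 0

/-! ### The MCARMA process and the noise of the sampled process -/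

/-- `Y 0, …, Y (p - 1)` are the Ornstein–Uhlenbeck processes
`Y_k(t) = e^{R_k t} Y_k(0) + ∫_0^t e^{R_k (t-u)} G_k dL(u)` with initial values such that
`V(R₁, …, R_p) [Y₁(0)ᵀ, …, Y_p(0)ᵀ]ᵀ` is real. -/
structure IsOUFamily {d m p : ℕ} (P : Measure Ω) (L : ℝ≥0 → Ω → (Fin m → ℝ))
    (R : Fin p → Matrix (Fin d) (Fin d) ℂ) (G : Fin p → Matrix (Fin d) (Fin m) ℂ)
    (Y : Fin p → ℝ≥0 → Ω → (Fin d → ℂ)) : Prop where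
  measurable_zero : ∀ k, Measurable (Y k 0)
  real_zero : ∀ᵐ ω ∂P, ∀ x : Fin p × Fin d,
    ((blockVandermonde R).mulVec (fun y : Fin p × Fin d => Y y.1 0 ω y.2) x).im = 0
  eq : ∀ k (t : ℝ≥0), Y k t =ᵐ[P] fun ω =>
    (mexp t (R k)).mulVec (Y k 0 ω) +
      stochInt P L (fun u => mexp (t - u) (R k) * G k) 0 t ω

/-- The noise `U_n = Φ(B) Y(nh) = Y(nh) - ∑_{j=1}^p Φ_j Y((n-j)h)` for `n ≥ p`, where
`Y = ∑_k Y_k`. -/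
def noise {d p : ℕ} (h : ℝ≥0) (R : Fin p → Matrix (Fin d) (Fin d) ℂ)
    (Y : Fin p → ℝ≥0 → Ω → (Fin d → ℂ)) (n : ℕ) (ω : Ω) : Fin d → ℂ :=
  (∑ k, Y k (n * h) ω) -
    ∑ j ∈ Finset.Icc 1 p, (phi h R j).mulVec (∑ k, Y k ((n - j : ℕ) * h) ω)

/-- `N_{ν,1} = ∫_0^h e^{R_ν (h-u)} G_ν dL(u)`. -/
def ouNoise {d m p : ℕ} (P : Measure Ω) (L : ℝ≥0 → Ω → (Fin m → ℝ)) (h : ℝ≥0)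
    (R : Fin p → Matrix (Fin d) (Fin d) ℂ) (G : Fin p → Matrix (Fin d) (Fin m) ℂ) (ν : Fin p) :
    Ω → (Fin d → ℂ) :=
  stochInt P L (fun u => mexp (h - u) (R ν) * G ν) 0 h

/-- `Σ_L = Cov(L(1))`. -/
def covL {m : ℕ} (P : Measure Ω) (L : ℝ≥0 → Ω → (Fin m → ℝ)) : Matrix (Fin m) (Fin m) ℂ :=
  cov P (fun ω c => (L 1 ω c : ℂ)) (fun ω c => (L 1 ω c : ℂ))

/-- `Σ_{ν,μ} = ∫_0^h e^{R_ν u} G_ν Σ_L G_μᴴ e^{R_μᴴ u} du` (entrywise). -/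
def sigmaH {d m p : ℕ} (h : ℝ) (SL : Matrix (Fin m) (Fin m) ℂ)
    (R : Fin p → Matrix (Fin d) (Fin d) ℂ) (G : Fin p → Matrix (Fin d) (Fin m) ℂ)
    (ν μ : Fin p) : Matrix (Fin d) (Fin d) ℂ :=
  Matrix.of fun a b => ∫ u in (0 : ℝ)..h,
    (mexp u (R ν) * G ν * SL * (G μ).conjTranspose * mexp u (R μ).conjTranspose) a b

/-- `e^{hrR_ν} - ∑_{j=1}^r Φ_j e^{h(r-j)R_ν}`. -/
def coeff {d p : ℕ} (h : ℝ) (R : Fin p → Matrix (Fin d) (Fin d) ℂ) (r : ℕ) (ν : Fin p) :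
    Matrix (Fin d) (Fin d) ℂ :=
  mexp (h * r) (R ν) - ∑ j ∈ Finset.Icc 1 r, phi h R j * mexp (h * ((r : ℝ) - j)) (R ν)

end

end MCARMA

/-! The coefficients `phi` come from a monic matrix polynomial whose right solvents are the
`e^{-hR_k}`, which gives `∑_j Φ_j e^{-jhR_k} = I` for every `k` (`sum_phi_mul_mexp`). The
autoregressive filter therefore kills every sampled orbit `e^{tR_k}` (`mexp_sub_sum_phi_mul_mexp`).
Consequently the initial values drop out of `U_n`, and so does the noise from before time `(n-p)h`.

What remains is `U_n = ∫ K_n dL` with a deterministic kernel `K_n` (`noiseKernel`). Number the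
sampling intervals backwards from `nh`. On the `r`-th one, `K_n` equals `∑_k coeff r k ·
e^{((n-r)h-u)R_k} G_k` if `r < p`, and vanishes if `r ≥ p`. The covariance formula is then the
isometry `E[∫φ dL (∫ψ dL)ᴴ] = ∫ φ Σ_L ψᴴ`, split over these intervals. Each interval contributes a
shifted copy of `sigmaH`, and interval `r` of `U_n` is interval `r + l` of `U_{n+l}`. At lags `l ≥
p` no interval carries both kernels.

The isometry rests on `E[L_s^c L_t^{c'}] = min(s,t) (Σ_L)_{cc'}`. The Wiener integral is treated as
a closed linear relation `wienerGraph` between random variables and integrands, so no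
well-definedness on simple functions has to be checked beforehand: the isometry extends from
generators by sesquilinearity and continuity, and yields single-valuedness. Finally,
`hasWienerInt_stochInt` identifies `stochInt`, a limit in probability of Riemann sums, with this
integral. -/

namespace MCARMA

/-! ### Moments of square integrable Lévy processes -/

/-- A nonnegative additive function on `[0, ∞)` is linear. -/
lemma eq_mul_of_additive_nonneg {f : ℝ≥0 → ℝ} (hadd : ∀ s t, f (s + t) = f s + f t)
    (hf : ∀ t, 0 ≤ f t) (t : ℝ≥0) : f t = t * f 1 := by
  have hmono : Monotone f := fun a b hab => by
    obtain ⟨c, rfl⟩ := exists_add_of_le hab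
    rw [hadd]; linarith [hf c]
  have hmul : ∀ (n : ℕ) (s : ℝ≥0), f (n * s) = n * f s := by
    intro n s
    induction n with
    | zero => have := hadd 0 0; simp at this ⊢; linarith
    | succ k ih => push_cast; rw [add_mul, one_mul, hadd, ih]; ring
  have hnat : ∀ n : ℕ, f n = n * f 1 := fun n => by simpa using hmul n 1
  -- With `k = ⌊nt⌋`, both `f (nt)` and `nt · f 1` lie between `k · f 1` and `(k+1) · f 1`. Their
  -- distance is thus at most `f 1` for every `n`, which forces equality.
  have key : ∀ n : ℕ, n * |f t - t * f 1| ≤ f 1 := by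
    intro n
    have h1 : (⌊n * t⌋₊ : ℝ≥0) ≤ n * t := Nat.floor_le zero_le
    have h2 : n * t ≤ (⌊n * t⌋₊ + 1 : ℕ) := by
      push_cast; exact (Nat.lt_floor_add_one _).le
    have h3 := hmono h1
    have h4 := hmono h2
    rw [hnat, hmul] at h3 h4
    have h1' : (⌊n * t⌋₊ : ℝ) ≤ n * t := by exact_mod_cast h1
    have h2' : (n * t : ℝ) ≤ (⌊n * t⌋₊ + 1 : ℕ) := by exact_mod_cast h2
    have h5 := mul_le_mul_of_nonneg_right h1' (hf 1)
    have h6 := mul_le_mul_of_nonneg_right h2' (hf 1)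
    push_cast at h4 h6
    rw [← abs_of_nonneg (Nat.cast_nonneg n : (0 : ℝ) ≤ n), ← abs_mul, abs_le]
    constructor <;> nlinarith
  by_contra hne
  have hpos : 0 < |f t - t * f 1| := abs_pos.2 (sub_ne_zero.2 hne)
  obtain ⟨n, hn⟩ := exists_nat_gt (f 1 / |f t - t * f 1|)
  rw [div_lt_iff₀ hpos] at hn
  linarith [key n]

/-- If the sum of two independent random variables is square integrable, so is the first one. -/
lemma memLp_two_of_indepFun_add {Ω : Type*} [MeasurableSpace Ω] {P : Measure Ω}
    [IsProbabilityMeasure P] {X Y : Ω → ℝ} (hX : Measurable X) (hY : Measurable Y)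
    (hXY : X ⟂ᵢ[P] Y) (h : MemLp (X + Y) 2 P) : MemLp X 2 P := by
  have hprod := (indepFun_iff_map_prod_eq_prod_map_map hX.aemeasurable hY.aemeasurable).1 hXY
  have := Measure.isProbabilityMeasure_map (μ := P) hX.aemeasurable
  have := Measure.isProbabilityMeasure_map (μ := P) hY.aemeasurable
  have hint : Integrable (fun z : ℝ × ℝ => (z.1 + z.2) ^ 2) ((P.map X).prod (P.map Y)) := by
    rw [← hprod, integrable_map_measure (by fun_prop) (by fun_prop)]
    exact h.integrable_sq
  -- By Fubini some fixed `y` makes `x + y` square integrable under the law of `X`; subtracting a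
  -- constant then gives `X` itself.
  obtain ⟨y, hy⟩ := hint.prod_left_ae.exists
  have hm : MemLp (fun x : ℝ => x + y) 2 (P.map X) :=
    (memLp_two_iff_integrable_sq (by fun_prop)).2 hy
  have hm' : MemLp (fun x : ℝ => x) 2 (P.map X) := by
    convert hm.sub (memLp_const y) using 1
    ext x; simp
  exact (memLp_map_measure_iff (by fun_prop) hX.aemeasurable).1 hm'

/-- A real-valued process with independent stationary increments, right-continuous at `0`. -/
structure IsRealLevy {Ω : Type*} [MeasurableSpace Ω] (P : Measure Ω) (X : ℝ≥0 → Ω → ℝ) :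
    Prop where
  measurable : ∀ t, Measurable (X t)
  zero : ∀ᵐ ω ∂P, X 0 ω = 0
  indep : HasIndepIncrements X P
  stationary : ∀ s t : ℝ≥0, IdentDistrib (fun ω => X (s + t) ω - X s ω) (X t) P P
  continuousAt_zero : ∀ᵐ ω ∂P, ContinuousAt (fun s => X s ω) 0

/-- Scalar projections reduce second moments to the real case; the directions `e_c` and `e_c + e_c'`
suffice, by polarisation. -/
lemma IsLevyProcess.dotProduct {Ω : Type*} [MeasurableSpace Ω] {P : Measure Ω} {m : ℕ}
    {L : ℝ≥0 → Ω → (Fin m → ℝ)} (hL : IsLevyProcess P L) (w : Fin m → ℝ) :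
    IsRealLevy P fun t ω => ∑ c, w c * L t ω c := by
  let f : (Fin m → ℝ) →+ ℝ :=
    { toFun := fun x => ∑ c, w c * x c
      map_zero' := by simp
      map_add' := fun x y => by simp [mul_add, Finset.sum_add_distrib] }
  have hf : Measurable f := by
    change Measurable fun x : Fin m → ℝ => ∑ c, w c * x c
    fun_prop
  refine ⟨fun t => hf.comp (hL.measurable t), ?_, hL.indep.map' hf, fun s t => ?_, ?_⟩
  · filter_upwards [hL.zero] with ω hω
    simp [hω]
  · have h := (hL.stationary s t).comp hf
    have h' : (f ∘ fun ω => L (s + t) ω - L s ω) = fun ω => f (L (s + t) ω) - f (L s ω) := by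
      ext ω
      exact map_sub f _ _
    rw [h'] at h
    exact h
  · filter_upwards [hL.cadlag] with ω hω
    have h0 := (hω 0).1
    have : Set.Ici (0 : ℝ≥0) = Set.univ := by ext; simp
    rw [this, continuousWithinAt_univ, continuousAt_pi] at h0
    exact tendsto_finsetSum _ fun c _ => (h0 c).const_mul (w c)

namespace IsRealLevy

variable {Ω : Type*} [MeasurableSpace Ω] {P : Measure Ω} {X : ℝ≥0 → Ω → ℝ}

lemma indepFun_sub (hX : IsRealLevy P X) (s t : ℝ≥0) :
    X s ⟂ᵢ[P] (fun ω => X (s + t) ω - X s ω) :=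
  hX.indep.indepFun_eval_sub zero_le le_self_add hX.zero

lemma memLp_add (hX : IsRealLevy P X) {s t : ℝ≥0} (hs : MemLp (X s) 2 P) (ht : MemLp (X t) 2 P) :
    MemLp (X (s + t)) 2 P := by
  convert hs.add ((hX.stationary s t).memLp_iff.2 ht) using 1
  ext ω; simp

variable [IsProbabilityMeasure P]

lemma memLp_of_le (hX : IsRealLevy P X) {s t : ℝ≥0} (hst : s ≤ t) (ht : MemLp (X t) 2 P) :
    MemLp (X s) 2 P := by
  obtain ⟨c, rfl⟩ := exists_add_of_le hst
  refine memLp_two_of_indepFun_add (hX.measurable s) ((hX.measurable _).sub (hX.measurable s))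
    (hX.indepFun_sub s c) ?_
  convert ht using 1
  ext ω; simp

/-- Stationarity carries square integrability from time `1` to all integers; it passes down to any
earlier time because `X s` is an independent summand of `X t`. -/
lemma memLp (hX : IsRealLevy P X) (h1 : MemLp (X 1) 2 P) (t : ℝ≥0) : MemLp (X t) 2 P := by
  have hn : ∀ n : ℕ, MemLp (X n) 2 P := by
    intro n
    induction n with
    | zero => exact hX.memLp_of_le (by simp) h1
    | succ k ih => push_cast; exact hX.memLp_add ih h1
  obtain ⟨n, hn'⟩ := exists_nat_ge t
  exact hX.memLp_of_le hn' (hn n)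

lemma variance_eq (hX : IsRealLevy P X) (h1 : MemLp (X 1) 2 P) (t : ℝ≥0) :
    variance (X t) P = t * variance (X 1) P := by
  refine eq_mul_of_additive_nonneg (f := fun t => variance (X t) P) (fun s t => ?_)
    (fun t => variance_nonneg _ _) t
  have h := (hX.indepFun_sub s t).variance_add (hX.memLp h1 s)
    ((hX.stationary s t).memLp_iff.2 (hX.memLp h1 t))
  rw [(hX.stationary s t).variance_eq] at h
  rw [← h]
  congr 1
  ext ω; simp

lemma integral_add (hX : IsRealLevy P X) (h1 : MemLp (X 1) 2 P) (s t : ℝ≥0) :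
    ∫ ω, X (s + t) ω ∂P = ∫ ω, X s ω ∂P + ∫ ω, X t ω ∂P := by
  have hi := fun t => (hX.memLp h1 t).integrable one_le_two
  rw [← (hX.stationary s t).integral_eq, integral_sub (hi _) (hi _)]
  ring

/-- The mean is additive but has no sign, so `eq_mul_of_additive_nonneg` does not apply and path
regularity takes over. Times `r n → 0` with the same mean as `t` are used: `X (r n)` tends to that
mean in `L²`, since the variance is linear in time, and to `0` almost surely by right-continuity. -/
lemma integral_eq_zero (hX : IsRealLevy P X) (h1 : MemLp (X 1) 2 P) (h0 : ∫ ω, X 1 ω ∂P = 0)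
    (t : ℝ≥0) : ∫ ω, X t ω ∂P = 0 := by
  set μ : ℝ≥0 → ℝ := fun t => ∫ ω, X t ω ∂P with hμ
  have hadd : ∀ s t, μ (s + t) = μ s + μ t := hX.integral_add h1
  have hmul : ∀ (n : ℕ) (s : ℝ≥0), μ (n * s) = n * μ s := by
    intro n s
    induction n with
    | zero => have := hadd 0 0; simp at this ⊢; linarith
    | succ k ih => push_cast; rw [add_mul, one_mul, hadd, ih]; ring
  -- The remainder of `t` modulo `1/(n+1)`. The mean vanishes at `1/(n+1)`, hence at its multiples,
  -- so removing them leaves the mean unchanged.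
  let r : ℕ → ℝ≥0 := fun n => t - ⌊(n + 1 : ℕ) * t⌋₊ * ((n + 1 : ℕ) : ℝ≥0)⁻¹
  have hr_le : ∀ n, ⌊(n + 1 : ℕ) * t⌋₊ * ((n + 1 : ℕ) : ℝ≥0)⁻¹ ≤ t := fun n => by
    rw [← div_eq_mul_inv, div_le_iff₀ (by positivity), mul_comm t]
    exact Nat.floor_le zero_le
  have hμr : ∀ n, μ (r n) = μ t := fun n => by
    have h2 : μ ((n + 1 : ℕ) : ℝ≥0)⁻¹ = 0 := by
      have := hmul (n + 1) ((n + 1 : ℕ) : ℝ≥0)⁻¹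
      rw [mul_inv_cancel₀ (by positivity)] at this
      have h3 : μ 1 = 0 := h0
      rw [h3] at this
      simpa [Nat.cast_add_one_ne_zero] using this.symm
    have h4 := hadd (r n) (⌊(n + 1 : ℕ) * t⌋₊ * ((n + 1 : ℕ) : ℝ≥0)⁻¹)
    rw [tsub_add_cancel_of_le (hr_le n), hmul, h2] at h4
    linarith
  have hr : Tendsto r atTop (𝓝 0) := by
    have h5 : ∀ n, r n ≤ 1 / ((n : ℝ≥0) + 1) := fun n => by
      rw [tsub_le_iff_right, ← div_eq_mul_inv, Nat.cast_add_one, ← add_div,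
        le_div_iff₀ (by positivity), mul_comm, add_comm 1]
      have := (Nat.lt_floor_add_one ((n + 1 : ℕ) * t)).le
      push_cast at this ⊢
      exact this
    exact tendsto_of_tendsto_of_tendsto_of_le_of_le tendsto_const_nhds
      tendsto_one_div_add_atTop_nhds_zero_nat (fun _ => zero_le) h5
  -- the centred variables tend to zero in mean square, the variables almost surely
  have hL2 : Tendsto (fun n => eLpNorm (fun ω => X (r n) ω - μ t) 2 P) atTop (𝓝 0) := by
    have h6 : ∀ n, eLpNorm (fun ω => X (r n) ω - μ t) 2 P =
        ENNReal.ofReal (r n * variance (X 1) P) ^ (1 / 2 : ℝ) := fun n => by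
      rw [← hX.variance_eq h1, ofReal_variance (hX.memLp h1 _), evariance_eq_lintegral_ofReal,
        ← hμr n, eLpNorm_eq_lintegral_rpow_enorm_toReal (by norm_num) (by norm_num)]
      simp only [ENNReal.toReal_ofNat, ENNReal.rpow_ofNat, ← ofReal_norm]
      congr 2
      ext ω
      rw [← ENNReal.ofReal_pow (norm_nonneg _), Real.norm_eq_abs, sq_abs]
    simp only [h6]
    have h7 : Tendsto (fun n => ((r n : ℝ) * variance (X 1) P)) atTop (𝓝 0) := by
      simpa using (NNReal.tendsto_coe.2 hr).mul_const (variance (X 1) P)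
    have h7' := ((ENNReal.continuous_rpow_const (y := 1 / 2)).tendsto _).comp
      ((ENNReal.continuous_ofReal.tendsto 0).comp h7)
    rw [ENNReal.ofReal_zero, ENNReal.zero_rpow_of_pos (by norm_num)] at h7'
    exact h7'
  have hmeas := tendstoInMeasure_of_tendsto_eLpNorm (f := fun n ω => X (r n) ω - μ t)
    (g := fun _ => (0 : ℝ)) (p := 2) (μ := P) (by norm_num)
    (fun n => ((hX.measurable _).sub_const _).aestronglyMeasurable)
    aestronglyMeasurable_const (by simpa [Pi.sub_def] using hL2)
  obtain ⟨ns, hns, hlim⟩ := hmeas.exists_seq_tendsto_ae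
  obtain ⟨ω, h8, h9, h10⟩ := (hlim.and (hX.zero.and hX.continuousAt_zero)).exists
  have h11 : Tendsto (fun i => X (r (ns i)) ω) atTop (𝓝 0) := by
    have := h10.tendsto.comp (hr.comp hns.tendsto_atTop)
    rwa [h9] at this
  have h12 := h11.sub h8
  simp only [sub_sub_cancel, sub_zero] at h12
  exact tendsto_nhds_unique tendsto_const_nhds h12

end IsRealLevy

namespace IsLevyProcess

variable {Ω : Type*} [MeasurableSpace Ω] {P : Measure Ω} {m : ℕ} {L : ℝ≥0 → Ω → (Fin m → ℝ)}

lemma eval (hL : IsLevyProcess P L) (c : Fin m) : IsRealLevy P fun t ω => L t ω c := by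
  simpa [Pi.single_apply] using hL.dotProduct (Pi.single c 1)

lemma eval_add_eval (hL : IsLevyProcess P L) (c c' : Fin m) :
    IsRealLevy P fun t ω => L t ω c + L t ω c' := by
  simpa [Pi.single_apply, add_mul, Finset.sum_add_distrib] using hL.dotProduct
    fun i => (Pi.single c 1 : Fin m → ℝ) i + (Pi.single c' 1 : Fin m → ℝ) i

variable [IsProbabilityMeasure P]

lemma memLp_eval (hL : IsLevyProcess P L) (hL2 : MemLp (L 1) 2 P) (t : ℝ≥0) (c : Fin m) :
    MemLp (fun ω => L t ω c) 2 P :=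
  (hL.eval c).memLp (hL2.eval c) t

lemma integral_eval (hL : IsLevyProcess P L) (hL2 : MemLp (L 1) 2 P)
    (hL0 : ∫ ω, L 1 ω ∂P = 0) (t : ℝ≥0) (c : Fin m) : ∫ ω, L t ω c ∂P = 0 := by
  refine (hL.eval c).integral_eq_zero (hL2.eval c) ?_ t
  have := eval_integral (μ := P) (f := L 1) (fun i => (hL2.eval i).integrable one_le_two) c
  rw [hL0] at this
  simpa using this.symm

/-- `E[L_t^c L_t^{c'}] = t E[L_1^c L_1^{c'}]`. -/
lemma integral_mul_self (hL : IsLevyProcess P L) (hL2 : MemLp (L 1) 2 P)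
    (hL0 : ∫ ω, L 1 ω ∂P = 0) (t : ℝ≥0) (c c' : Fin m) :
    ∫ ω, L t ω c * L t ω c' ∂P = t * ∫ ω, L 1 ω c * L 1 ω c' ∂P := by
  -- Polarisation: the mixed moment is expressed through three variances, each linear in time.
  have key : ∀ t : ℝ≥0, ∫ ω, L t ω c * L t ω c' ∂P =
      (variance (fun ω => L t ω c + L t ω c') P - variance (fun ω => L t ω c) P
        - variance (fun ω => L t ω c') P) / 2 := fun t => by
    have h1 := variance_fun_add (hL.memLp_eval hL2 t c) (hL.memLp_eval hL2 t c')
    rw [h1, covariance_eq_sub (hL.memLp_eval hL2 t c) (hL.memLp_eval hL2 t c'),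
      hL.integral_eval hL2 hL0 t c]
    simp only [Pi.mul_apply]
    ring
  rw [key, key, (hL.eval c).variance_eq (hL2.eval c) t, (hL.eval c').variance_eq (hL2.eval c') t,
    (hL.eval_add_eval c c').variance_eq ((hL2.eval c).add (hL2.eval c')) t]
  ring

/-- `L t - L s` is independent of `L s` and `L s` is centred, so only the second moment at time `s`
survives. -/
lemma integral_mul_of_le (hL : IsLevyProcess P L) (hL2 : MemLp (L 1) 2 P)
    (hL0 : ∫ ω, L 1 ω ∂P = 0) {s t : ℝ≥0} (hst : s ≤ t) (c c' : Fin m) :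
    ∫ ω, L s ω c * L t ω c' ∂P = s * ∫ ω, L 1 ω c * L 1 ω c' ∂P := by
  have hind := (hL.indep.indepFun_eval_sub zero_le hst hL.zero).comp (measurable_pi_apply c)
    (measurable_pi_apply c')
  have hm := hL.memLp_eval hL2
  have h1 := hind.integral_fun_mul_eq_mul_integral (hm s c).aestronglyMeasurable
    ((hm t c').sub (hm s c')).aestronglyMeasurable
  have h2 : ∫ ω, L s ω c * (L t ω c' - L s ω c') ∂P = 0 := by
    refine h1.trans ?_
    have h3 : ∫ ω, L s ω c ∂P = 0 := hL.integral_eval hL2 hL0 s c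
    change (∫ ω, L s ω c ∂P) * _ = 0
    rw [h3, zero_mul]
  simp only [mul_sub] at h2
  have hi : ∀ t, Integrable (fun ω => L s ω c * L t ω c') P := fun t =>
    (hm s c).integrable_mul (hm t c')
  rw [integral_sub (hi t) (hi s),
    hL.integral_mul_self hL2 hL0] at h2
  linarith

/-- `E[L_s^c L_t^{c'}] = min(s, t) E[L_1^c L_1^{c'}]`. -/
lemma integral_mul (hL : IsLevyProcess P L) (hL2 : MemLp (L 1) 2 P)
    (hL0 : ∫ ω, L 1 ω ∂P = 0) (s t : ℝ≥0) (c c' : Fin m) :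
    ∫ ω, L s ω c * L t ω c' ∂P = (min s t : ℝ≥0) * ∫ ω, L 1 ω c * L 1 ω c' ∂P := by
  rcases le_total s t with h | h
  · rw [hL.integral_mul_of_le hL2 hL0 h, min_eq_left h]
  · simp_rw [mul_comm (L _ _ c)]
    rw [hL.integral_mul_of_le hL2 hL0 h, min_eq_right h]

lemma covL_apply (hL : IsLevyProcess P L) (hL2 : MemLp (L 1) 2 P)
    (hL0 : ∫ ω, L 1 ω ∂P = 0) (c c' : Fin m) :
    covL P L c c' = ((∫ ω, L 1 ω c * L 1 ω c' ∂P : ℝ) : ℂ) := by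
  have h0 : ∀ c, ∫ ω, (L 1 ω c : ℂ) ∂P = 0 := fun c => by
    rw [integral_complex_ofReal, hL.integral_eval hL2 hL0, Complex.ofReal_zero]
  simp only [covL, cov, Matrix.of_apply, h0, sub_zero]
  rw [← integral_complex_ofReal]
  simp

/-- `E[L_s^c L_t^{c'}] = min(s, t) (Σ_L)_{c c'}`, for the complexified process. -/
lemma integral_mul_star (hL : IsLevyProcess P L) (hL2 : MemLp (L 1) 2 P)
    (hL0 : ∫ ω, L 1 ω ∂P = 0) (s t : ℝ≥0) (c c' : Fin m) :
    ∫ ω, (L s ω c : ℂ) * star (L t ω c' : ℂ) ∂P = (min s t : ℝ≥0) * covL P L c c' := by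
  rw [hL.covL_apply hL2 hL0]
  have := congrArg (fun x : ℝ => (x : ℂ)) (hL.integral_mul hL2 hL0 s t c c')
  simp only [← integral_complex_ofReal] at this
  simpa using this

lemma memLp_ofReal_eval (hL : IsLevyProcess P L) (hL2 : MemLp (L 1) 2 P) (t : ℝ≥0) (c : Fin m) :
    MemLp (fun ω => (L t ω c : ℂ)) 2 P :=
  (hL.memLp_eval hL2 t c).ofReal

end IsLevyProcess

/-! ### The Wiener integral with respect to a Lévy process -/

section Wiener

variable {Ω : Type*} [MeasurableSpace Ω] (P : Measure Ω) {m : ℕ} (L : ℝ≥0 → Ω → (Fin m → ℝ))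

/-- Pairs of a square integrable random variable and a square integrable row function. -/
abbrev PairSpace (P : Measure Ω) (m : ℕ) :=
  Lp ℂ 2 P × (Fin m → Lp ℂ 2 (volume : Measure ℝ))

/-- The pairs `(z, φ)` of square integrable functions such that `φ` is a linear combination of the
functions `1_{(0, t]} e_c` and `z` the same combination of the random variables `L_t^c`. -/
noncomputable def simpleGraph : Submodule ℂ (PairSpace P m) :=
  Submodule.span ℂ {x | ∃ (t : ℝ≥0) (c : Fin m), x.1 =ᵐ[P] (fun ω => (L t ω c : ℂ)) ∧
    x.2 = Pi.single c (indicatorConstLp 2 (measurableSet_Ioc (a := (0 : ℝ)) (b := t))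
      measure_Ioc_lt_top.ne 1)}

/-- The graph of the Wiener integral: the closure of `simpleGraph`. -/
noncomputable def wienerGraph : Submodule ℂ (PairSpace P m) :=
  (simpleGraph P L).topologicalClosure

variable {P L} in
lemma wienerGraph_induction {p : PairSpace P m → Prop} (hp : IsClosed {x | p x})
    (hs : ∀ x ∈ simpleGraph P L, p x) {x : PairSpace P m} (hx : x ∈ wienerGraph P L) : p x :=
  closure_minimal (s := (simpleGraph P L : Set (PairSpace P m))) hs hp hx

/-- `z = ∫ φ dL` as a Wiener integral over `(0, ∞)`. -/
def HasWienerInt (z : Ω → ℂ) (φ : ℝ → Fin m → ℂ) : Prop :=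
  ∃ (hz : MemLp z 2 P) (hφ : ∀ c, MemLp (fun u => φ u c) 2 (volume : Measure ℝ)),
    (hz.toLp z, fun c => (hφ c).toLp _) ∈ wienerGraph P L

variable {P L} [IsProbabilityMeasure P]

/-- Both sides equal `min(s,t) (Σ_L)_{cc'}`: the minimum is the length of `(0,s] ∩ (0,t]`. -/
lemma inner_eq_of_generator (hL : IsLevyProcess P L) (hL2 : MemLp (L 1) 2 P)
    (hL0 : ∫ ω, L 1 ω ∂P = 0) {s t : ℝ≥0} {c c' : Fin m} {z z' : Lp ℂ 2 P}
    (hz : z =ᵐ[P] fun ω => (L s ω c : ℂ)) (hz' : z' =ᵐ[P] fun ω => (L t ω c' : ℂ)) :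
    inner ℂ z' z = covL P L c c' *
      inner ℂ (indicatorConstLp 2 (measurableSet_Ioc (a := (0 : ℝ)) (b := t))
        measure_Ioc_lt_top.ne (1 : ℂ) : Lp ℂ 2 (volume : Measure ℝ))
        (indicatorConstLp 2 (measurableSet_Ioc (a := (0 : ℝ)) (b := s))
          measure_Ioc_lt_top.ne (1 : ℂ)) := by
  have h1 : inner ℂ z' z = ∫ ω, (L s ω c : ℂ) * star (L t ω c' : ℂ) ∂P := by
    rw [L2.inner_def]
    refine integral_congr_ae ?_
    filter_upwards [hz, hz'] with ω h h'
    rw [h, h']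
    rfl
  rw [h1, hL.integral_mul_star hL2 hL0, L2.inner_indicatorConstLp_indicatorConstLp
    measurableSet_Ioc measurableSet_Ioc measure_Ioc_lt_top.ne measure_Ioc_lt_top.ne,
    Set.Ioc_inter_Ioc]
  simp [measureReal_def, mul_comm, min_comm, ← NNReal.coe_min, -ENNReal.coe_min]

/-- Both sides are sesquilinear and continuous in `(x, y)`, so agreement on generators extends to
the span and then, one variable at a time, to the closure. -/
lemma inner_eq_of_mem_wienerGraph (hL : IsLevyProcess P L) (hL2 : MemLp (L 1) 2 P)
    (hL0 : ∫ ω, L 1 ω ∂P = 0) {x y : PairSpace P m}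
    (hx : x ∈ wienerGraph P L) (hy : y ∈ wienerGraph P L) :
    inner ℂ y.1 x.1 = ∑ c, ∑ c', covL P L c c' * inner ℂ (y.2 c') (x.2 c) := by
  have h1 : ∀ x ∈ simpleGraph P L, ∀ y ∈ simpleGraph P L,
      inner ℂ y.1 x.1 = ∑ c, ∑ c', covL P L c c' * inner ℂ (y.2 c') (x.2 c) := by
    intro x hx y hy
    induction hx, hy using Submodule.span_induction₂ with
    | mem_mem x y hx hy =>
      obtain ⟨s, c, hz, hφ⟩ := hx
      obtain ⟨t, c', hz', hφ'⟩ := hy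
      rw [inner_eq_of_generator hL hL2 hL0 hz hz', hφ, hφ', Finset.sum_eq_single c,
        Finset.sum_eq_single c']
      · simp
      · intro b _ hb; simp [Pi.single_eq_of_ne hb]
      · simp
      · intro b _ hb; simp [Pi.single_eq_of_ne hb]
      · simp
    | zero_left => simp
    | zero_right => simp
    | add_left x y z _ _ _ h h' =>
      simp [inner_add_right, h, h', mul_add, Finset.sum_add_distrib]
    | add_right x y z _ _ _ h h' =>
      simp [inner_add_left, h, h', mul_add, Finset.sum_add_distrib]
    | smul_left r x y _ _ h =>
      simp only [Prod.smul_fst, Prod.smul_snd, Pi.smul_apply, inner_smul_right, h, Finset.mul_sum]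
      exact Finset.sum_congr rfl fun _ _ => Finset.sum_congr rfl fun _ _ => by ring
    | smul_right r x y _ _ h =>
      simp only [Prod.smul_fst, Prod.smul_snd, Pi.smul_apply, inner_smul_left, h, Finset.mul_sum]
      exact Finset.sum_congr rfl fun _ _ => Finset.sum_congr rfl fun _ _ => by ring
  refine wienerGraph_induction (p := fun y => inner ℂ y.1 x.1 =
    ∑ c, ∑ c', covL P L c c' * inner ℂ (y.2 c') (x.2 c)) (isClosed_eq (by fun_prop) (by fun_prop))
    (fun y hy => ?_) hy
  exact wienerGraph_induction (p := fun x => inner ℂ y.1 x.1 =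
    ∑ c, ∑ c', covL P L c c' * inner ℂ (y.2 c') (x.2 c)) (isClosed_eq (by fun_prop) (by fun_prop))
    (fun x hx => h1 x hx y hy) hx

/-- Cauchy–Schwarz in the isometry. Applied to differences, it says that the integrand determines
the integral, with Lipschitz dependence. -/
lemma norm_sq_le_of_mem_wienerGraph (hL : IsLevyProcess P L) (hL2 : MemLp (L 1) 2 P)
    (hL0 : ∫ ω, L 1 ω ∂P = 0) {x : PairSpace P m}
    (hx : x ∈ wienerGraph P L) :
    ‖x.1‖ ^ 2 ≤ (∑ c, ∑ c', ‖covL P L c c'‖) * ‖x.2‖ ^ 2 := by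
  have h1 := congrArg norm (inner_eq_of_mem_wienerGraph hL hL2 hL0 hx hx)
  rw [inner_self_eq_norm_sq_to_K, norm_pow, RCLike.norm_ofReal, abs_norm] at h1
  rw [h1, Finset.sum_mul]
  refine (norm_sum_le _ _).trans (Finset.sum_le_sum fun c _ => ?_)
  rw [Finset.sum_mul]
  refine (norm_sum_le _ _).trans (Finset.sum_le_sum fun c' _ => ?_)
  rw [norm_mul, sq]
  gcongr
  exact (norm_inner_le_norm _ _).trans (mul_le_mul (norm_le_pi_norm x.2 c')
    (norm_le_pi_norm x.2 c) (norm_nonneg _) (norm_nonneg _))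

/-- The expectation is the inner product with the constant `1`, a continuous functional that
vanishes on generators. -/
lemma integral_eq_zero_of_mem_wienerGraph (hL : IsLevyProcess P L) (hL2 : MemLp (L 1) 2 P)
    (hL0 : ∫ ω, L 1 ω ∂P = 0) {x : PairSpace P m}
    (hx : x ∈ wienerGraph P L) : ∫ ω, x.1 ω ∂P = 0 := by
  let one : Lp ℂ 2 P := (memLp_const (1 : ℂ)).toLp _
  have h0 : ∀ z : Lp ℂ 2 P, inner ℂ one z = ∫ ω, z ω ∂P := fun z => by
    rw [L2.inner_def]
    refine integral_congr_ae ?_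
    filter_upwards [(memLp_const (μ := P) (p := 2) (1 : ℂ)).coeFn_toLp] with ω h
    simp [one]
  rw [← h0]
  refine wienerGraph_induction (p := fun x => inner ℂ one x.1 = 0)
    (isClosed_eq (by fun_prop) (by fun_prop)) (fun x hx => ?_) hx
  induction hx using Submodule.span_induction with
  | mem x hx =>
    obtain ⟨t, c, hz, -⟩ := hx
    rw [h0, integral_congr_ae hz, integral_complex_ofReal, hL.integral_eval hL2 hL0,
      Complex.ofReal_zero]
  | zero => simp
  | add x y _ _ h h' => simp [inner_add_right, h, h']
  | smul r x _ h => simp [inner_smul_right, h]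

end Wiener

section Wiener

variable {Ω : Type*} [MeasurableSpace Ω] {P : Measure Ω} {m : ℕ} {L : ℝ≥0 → Ω → (Fin m → ℝ)}
  {z z' : Ω → ℂ} {φ φ' : ℝ → Fin m → ℂ}

lemma inner_toLp_toLp {α : Type*} [MeasurableSpace α] {μ : Measure α} {f g : α → ℂ}
    (hf : MemLp f 2 μ) (hg : MemLp g 2 μ) :
    inner ℂ (hg.toLp g) (hf.toLp f) = ∫ a, f a * star (g a) ∂μ := by
  rw [L2.inner_def]
  refine integral_congr_ae ?_
  filter_upwards [hf.coeFn_toLp, hg.coeFn_toLp] with a h h'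
  rw [h, h']
  rfl

lemma norm_sub_sq_le_of_mem_wienerGraph [IsProbabilityMeasure P] (hL : IsLevyProcess P L)
    (hL2 : MemLp (L 1) 2 P) (hL0 : ∫ ω, L 1 ω ∂P = 0) {x y : PairSpace P m}
    (hx : x ∈ wienerGraph P L) (hy : y ∈ wienerGraph P L) :
    ‖x.1 - y.1‖ ^ 2 ≤ (∑ c, ∑ c', ‖covL P L c c'‖) * ‖x.2 - y.2‖ ^ 2 := by
  have h := norm_sq_le_of_mem_wienerGraph hL hL2 hL0 (sub_mem hx hy)
  rwa [Prod.fst_sub, Prod.snd_sub] at h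

lemma tendsto_fst_of_mem_wienerGraph [IsProbabilityMeasure P] (hL : IsLevyProcess P L)
    (hL2 : MemLp (L 1) 2 P) (hL0 : ∫ ω, L 1 ω ∂P = 0) {xs : ℕ → PairSpace P m} {x : PairSpace P m}
    (hxs : ∀ n, xs n ∈ wienerGraph P L) (hx : x ∈ wienerGraph P L)
    (hlim : Tendsto (fun n => (xs n).2) atTop (𝓝 x.2)) :
    Tendsto (fun n => (xs n).1) atTop (𝓝 x.1) := by
  rw [tendsto_iff_norm_sub_tendsto_zero] at hlim ⊢
  have hsq : Tendsto (fun n => ‖(xs n).1 - x.1‖ ^ 2) atTop (𝓝 0) :=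
    squeeze_zero (fun _ => by positivity) (fun n => norm_sub_sq_le_of_mem_wienerGraph hL hL2 hL0
      (hxs n) hx)
      (by simpa using (hlim.pow 2).const_mul (∑ c, ∑ c', ‖covL P L c c'‖))
  simpa [Function.comp_def] using (Real.continuous_sqrt.tendsto 0).comp hsq

/-- Convergent integrands make the integrals Cauchy; `L²` is complete and the graph is closed. -/
lemma exists_mem_wienerGraph_of_tendsto [IsProbabilityMeasure P] (hL : IsLevyProcess P L)
    (hL2 : MemLp (L 1) 2 P) (hL0 : ∫ ω, L 1 ω ∂P = 0) {xs : ℕ → PairSpace P m}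
    {φ : Fin m → Lp ℂ 2 (volume : Measure ℝ)} (hxs : ∀ n, xs n ∈ wienerGraph P L)
    (hlim : Tendsto (fun n => (xs n).2) atTop (𝓝 φ)) :
    ∃ z, (z, φ) ∈ wienerGraph P L := by
  have hC := hlim.cauchySeq
  set K := ∑ c, ∑ c', ‖covL P L c c'‖
  have hK0 : 0 ≤ K := by positivity
  have hbound : ∀ k n, ‖(xs k).1 - (xs n).1‖ ≤ √K * ‖(xs k).2 - (xs n).2‖ := fun k n => by
    rw [← Real.sqrt_sq (norm_nonneg ((xs k).2 - (xs n).2)), ← Real.sqrt_mul hK0]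
    exact Real.le_sqrt_of_sq_le (norm_sub_sq_le_of_mem_wienerGraph hL hL2 hL0
      (hxs k) (hxs n))
  have hC' : CauchySeq fun n => (xs n).1 := by
    rw [Metric.cauchySeq_iff] at hC ⊢
    intro ε hε
    -- The summand `1` keeps the divisor positive when `K = 0`.
    obtain ⟨N, hN⟩ := hC (ε / (√K + 1)) (by positivity)
    refine ⟨N, fun k hk n hn => ?_⟩
    have h4 := hN k hk n hn
    rw [dist_eq_norm, lt_div_iff₀ (by positivity)] at h4
    rw [dist_eq_norm]
    refine lt_of_le_of_lt (hbound k n) (lt_of_le_of_lt ?_ h4)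
    rw [mul_comm]
    gcongr
    linarith
  obtain ⟨z, hz⟩ := cauchySeq_tendsto_of_complete hC'
  exact ⟨z, (Submodule.isClosed_topologicalClosure _).mem_of_tendsto (hz.prodMk_nhds hlim)
    (Eventually.of_forall hxs)⟩

/-! ### Calculus of the Wiener integral for functions -/

namespace HasWienerInt

lemma memLp (h : HasWienerInt P L z φ) : MemLp z 2 P := h.1

lemma congr (h : HasWienerInt P L z φ) (hz : z =ᵐ[P] z') : HasWienerInt P L z' φ := by
  obtain ⟨h1, h2, h3⟩ := h
  refine ⟨h1.ae_eq hz, h2, ?_⟩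
  rwa [← MemLp.toLp_congr h1 (h1.ae_eq hz) hz]

lemma zero : HasWienerInt P L (fun _ => 0) (fun _ _ => 0) :=
  ⟨MemLp.zero, fun _ => MemLp.zero, (wienerGraph P L).zero_mem⟩

lemma add (h : HasWienerInt P L z φ) (h' : HasWienerInt P L z' φ') :
    HasWienerInt P L (fun ω => z ω + z' ω) (fun u c => φ u c + φ' u c) := by
  obtain ⟨h1, h2, h3⟩ := h
  obtain ⟨h1', h2', h3'⟩ := h'
  exact ⟨h1.add h1', fun c => (h2 c).add (h2' c), (wienerGraph P L).add_mem h3 h3'⟩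

lemma const_mul (h : HasWienerInt P L z φ) (r : ℂ) :
    HasWienerInt P L (fun ω => r * z ω) (fun u c => r * φ u c) := by
  obtain ⟨h1, h2, h3⟩ := h
  exact ⟨h1.const_mul r, fun c => (h2 c).const_mul r, (wienerGraph P L).smul_mem r h3⟩

lemma sub (h : HasWienerInt P L z φ) (h' : HasWienerInt P L z' φ') :
    HasWienerInt P L (fun ω => z ω - z' ω) (fun u c => φ u c - φ' u c) := by
  simpa [sub_eq_add_neg] using h.add (h'.const_mul (-1))

lemma sum {ι : Type*} (s : Finset ι) {z : ι → Ω → ℂ} {φ : ι → ℝ → Fin m → ℂ}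
    (h : ∀ i ∈ s, HasWienerInt P L (z i) (φ i)) :
    HasWienerInt P L (fun ω => ∑ i ∈ s, z i ω) (fun u c => ∑ i ∈ s, φ i u c) := by
  classical
  induction s using Finset.induction_on with
  | empty => simpa using zero
  | insert i s hi ih =>
    simp only [Finset.sum_insert hi]
    exact (h i (by simp)).add (ih fun j hj => h j (by simp [hj]))

variable [IsProbabilityMeasure P]

/-- The isometry property of the Wiener integral. -/
lemma integral_mul_star (hL : IsLevyProcess P L) (hL2 : MemLp (L 1) 2 P)
    (hL0 : ∫ ω, L 1 ω ∂P = 0) (h : HasWienerInt P L z φ) (h' : HasWienerInt P L z' φ') :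
    ∫ ω, z ω * star (z' ω) ∂P = ∑ c, ∑ c', covL P L c c' * ∫ u, φ u c * star (φ' u c') := by
  obtain ⟨h1, h2, h3⟩ := h
  obtain ⟨h1', h2', h3'⟩ := h'
  simpa only [inner_toLp_toLp] using inner_eq_of_mem_wienerGraph hL hL2 hL0 h3 h3'

lemma integral_eq_zero (hL : IsLevyProcess P L) (hL2 : MemLp (L 1) 2 P)
    (hL0 : ∫ ω, L 1 ω ∂P = 0) (h : HasWienerInt P L z φ) : ∫ ω, z ω ∂P = 0 := by
  obtain ⟨h1, h2, h3⟩ := h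
  rw [← integral_eq_zero_of_mem_wienerGraph hL hL2 hL0 h3]
  exact integral_congr_ae h1.coeFn_toLp.symm

lemma eval (hL : IsLevyProcess P L) (hL2 : MemLp (L 1) 2 P) (t : ℝ≥0) (c : Fin m) :
    HasWienerInt P L (fun ω => (L t ω c : ℂ))
      (fun u => Pi.single c ((Set.Ioc (0 : ℝ) t).indicator (fun _ => 1) u)) := by
  have h1 : MemLp ((Set.Ioc (0 : ℝ) t).indicator fun _ => (1 : ℂ)) 2 (volume : Measure ℝ) :=
    memLp_indicator_const 2 measurableSet_Ioc 1 (Or.inr measure_Ioc_lt_top.ne)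
  have h2 : ∀ c', MemLp (fun u => (Pi.single c ((Set.Ioc (0 : ℝ) t).indicator (fun _ => 1) u) :
      Fin m → ℂ) c') 2 (volume : Measure ℝ) := fun c' => by
    by_cases hc : c' = c
    · subst hc; simpa using h1
    · simp [Pi.single_eq_of_ne hc]
  have h3 := hL.memLp_ofReal_eval hL2 t c
  refine ⟨h3, h2, Submodule.le_topologicalClosure _
    (Submodule.subset_span ⟨t, c, h3.coeFn_toLp, ?_⟩)⟩
  funext c'
  by_cases hc : c' = c
  · subst hc
    simp only [Pi.single_eq_same]
    rfl
  · simp only [Pi.single_eq_of_ne hc]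
    exact MemLp.toLp_zero _

lemma increment (hL : IsLevyProcess P L) (hL2 : MemLp (L 1) 2 P) {s t : ℝ≥0} (hst : s ≤ t)
    (c : Fin m) : HasWienerInt P L (fun ω => ((L t ω c - L s ω c : ℝ) : ℂ))
      (fun u => Pi.single c ((Set.Ioc (s : ℝ) t).indicator (fun _ => 1) u)) := by
  have h := (eval hL hL2 t c).sub (eval hL hL2 s c)
  convert h using 1
  · ext ω; simp
  · ext u c'
    by_cases hc : c' = c
    · subst hc
      have hst' : (s : ℝ) ≤ t := hst
      simp only [Pi.single_eq_same, Set.indicator_apply, Set.mem_Ioc]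
      by_cases h1 : u ≤ s
      · by_cases h0 : 0 < u <;> simp [h1, h0, h1.not_gt, h1.trans hst']
      · have h0 : 0 < u := s.2.trans_lt (not_le.1 h1)
        simp [h1, h0, not_le.1 h1]
    · simp [Pi.single_eq_of_ne hc]

/-- Convergence of the integrands in mean square implies convergence of the Wiener integrals. -/
lemma tendsto_eLpNorm (hL : IsLevyProcess P L) (hL2 : MemLp (L 1) 2 P)
    (hL0 : ∫ ω, L 1 ω ∂P = 0) {zs : ℕ → Ω → ℂ} {φs : ℕ → ℝ → Fin m → ℂ}
    (hs : ∀ n, HasWienerInt P L (zs n) (φs n)) (h : HasWienerInt P L z φ)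
    (hlim : ∀ c, Tendsto (fun n => eLpNorm (fun u => φs n u c - φ u c) 2 volume) atTop (𝓝 0)) :
    Tendsto (fun n => eLpNorm (fun ω => zs n ω - z ω) 2 P) atTop (𝓝 0) := by
  choose h1 h2 h3 using hs
  obtain ⟨h1', h2', h3'⟩ := h
  have hφ : Tendsto (fun n => (fun c => (h2 n c).toLp _ : Fin m → Lp ℂ 2 (volume : Measure ℝ)))
      atTop (𝓝 fun c => (h2' c).toLp _) :=
    tendsto_pi_nhds.2 fun c => (Lp.tendsto_Lp_iff_tendsto_eLpNorm'' _ _ _ _).2 (hlim c)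
  exact (Lp.tendsto_Lp_iff_tendsto_eLpNorm'' zs h1 z h1').1
    (tendsto_fst_of_mem_wienerGraph hL hL2 hL0 (xs := fun n => ((h1 n).toLp _, _))
      (x := (h1'.toLp _, _)) h3 h3' hφ)

/-- Mean square limits of integrands of Wiener integrals are integrands of Wiener integrals. -/
lemma exists_of_tendsto (hL : IsLevyProcess P L) (hL2 : MemLp (L 1) 2 P)
    (hL0 : ∫ ω, L 1 ω ∂P = 0) {zs : ℕ → Ω → ℂ} {φs : ℕ → ℝ → Fin m → ℂ}
    (hs : ∀ n, HasWienerInt P L (zs n) (φs n))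
    (hφ : ∀ c, MemLp (fun u => φ u c) 2 (volume : Measure ℝ))
    (hlim : ∀ c, Tendsto (fun n => eLpNorm (fun u => φs n u c - φ u c) 2 volume) atTop (𝓝 0)) :
    ∃ z, HasWienerInt P L z φ := by
  choose h1 h2 h3 using hs
  have hφlim : Tendsto (fun n => (fun c => (h2 n c).toLp _ : Fin m → Lp ℂ 2 (volume : Measure ℝ)))
      atTop (𝓝 fun c => (hφ c).toLp _) :=
    tendsto_pi_nhds.2 fun c => (Lp.tendsto_Lp_iff_tendsto_eLpNorm'' _ _ _ _).2 (hlim c)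
  obtain ⟨z, hz⟩ := exists_mem_wienerGraph_of_tendsto hL hL2 hL0
    (xs := fun n => ((h1 n).toLp _, _)) h3 hφlim
  refine ⟨z, Lp.memLp z, hφ, ?_⟩
  rwa [Lp.toLp_coeFn]

end HasWienerInt

end Wiener

/-! ### Riemann sums and the stochastic integral -/

lemma sum_indicator_Ioc {t : ℕ → ℝ} (ht : Monotone t) (g : ℝ → ℂ) (N : ℕ) (u : ℝ) :
    ∑ k ∈ Finset.range N, (Set.Ioc (t k) (t (k + 1))).indicator g u =
      (Set.Ioc (t 0) (t N)).indicator g u := by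
  induction N with
  | zero => simp
  | succ N ih =>
    rw [Finset.sum_range_succ, ih, ← Set.Ioc_union_Ioc_eq_Ioc (ht (Nat.zero_le N)) (ht N.le_succ),
      Set.indicator_union_of_disjoint]
    exact Set.Ioc_disjoint_Ioc_of_le le_rfl

/-- The step function of a Riemann sum of `g` along `π`. -/
noncomputable def stepFun (g : ℝ → ℂ) {a b : ℝ≥0} (π : Subdivision a b) (u : ℝ) : ℂ :=
  ∑ k ∈ Finset.range π.size,
    (Set.Ioc (π.pt k : ℝ) (π.pt (k + 1))).indicator (fun _ => g (π.pt k)) u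

lemma norm_stepFun_sub_le {g : ℝ → ℂ} {a b : ℝ≥0} (π : Subdivision a b) {δ η : ℝ}
    (hη : ∀ x ∈ Set.Icc (a : ℝ) b, ∀ y ∈ Set.Icc (a : ℝ) b, dist x y < η → dist (g x) (g y) < δ)
    (hπ : (π.mesh : ℝ) < η) (u : ℝ) :
    ‖stepFun g π u - (Set.Ioc (a : ℝ) b).indicator g u‖ ≤
      ‖(Set.Ioc (a : ℝ) b).indicator (fun _ => δ) u‖ := by
  have hmono : Monotone fun k => (π.pt k : ℝ) := fun i j h => by exact_mod_cast π.mono h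
  by_cases hu : u ∈ Set.Ioc (a : ℝ) b
  -- For fixed `u`, the value `g u` and the bound `δ` are both spread over the subintervals as sums
  -- of indicators, so the comparison runs term by term; degenerate subintervals contribute nothing.
  · have h1 := sum_indicator_Ioc hmono (fun _ => g u) π.size u
    have h2 := sum_indicator_Ioc hmono (fun _ => (δ : ℂ)) π.size u
    rw [π.left, π.right, Set.indicator_of_mem hu] at h1 h2
    rw [Set.indicator_of_mem hu, Set.indicator_of_mem hu, ← h1, stepFun, ← Finset.sum_sub_distrib]
    have h3 : ‖δ‖ = ‖∑ k ∈ Finset.range π.size,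
        (Set.Ioc (π.pt k : ℝ) (π.pt (k + 1))).indicator (fun _ => δ) u‖ := by
      have h4 : ((∑ k ∈ Finset.range π.size,
          (Set.Ioc (π.pt k : ℝ) (π.pt (k + 1))).indicator (fun _ => δ) u : ℝ) : ℂ) = δ := by
        rw [← h2, Complex.ofReal_sum]
        refine Finset.sum_congr rfl fun k _ => ?_
        by_cases hk : u ∈ Set.Ioc (π.pt k : ℝ) (π.pt (k + 1)) <;> simp [hk]
      rw [Complex.ofReal_injective h4]
    rw [h3]
    refine (norm_sum_le _ _).trans (le_trans (Finset.sum_le_sum fun k hk => ?_) (le_abs_self _))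
    by_cases huk : u ∈ Set.Ioc (π.pt k : ℝ) (π.pt (k + 1))
    · rw [Set.indicator_of_mem huk, Set.indicator_of_mem huk, Set.indicator_of_mem huk,
        ← dist_eq_norm]
      have hk' := Finset.mem_range.1 hk
      have ha : (a : ℝ) ≤ π.pt k := by
        have := hmono (Nat.zero_le k); simpa only [π.left] using this
      have hb : (π.pt (k + 1) : ℝ) ≤ b := by
        have := hmono (Nat.succ_le_of_lt hk'); simpa only [π.right] using this
      refine (hη _ ⟨ha, (hmono k.le_succ).trans hb⟩ _ ⟨hu.1.le, hu.2⟩ ?_).le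
      have h5 : π.pt (k + 1) - π.pt k ≤ π.mesh :=
        Finset.le_sup (f := fun i => π.pt (i + 1) - π.pt i) hk
      have h6 : (π.pt (k + 1) : ℝ) - π.pt k ≤ π.mesh := by
        rw [← NNReal.coe_sub (π.mono k.le_succ)]; exact_mod_cast h5
      rw [Real.dist_eq, abs_sub_comm, abs_of_pos (sub_pos.2 huk.1)]
      linarith [huk.2]
    · simp [huk]
  · have h1 : stepFun g π u = 0 := by
      refine Finset.sum_eq_zero fun k hk => Set.indicator_of_notMem (fun huk => hu ?_) _
      have ha := hmono (Nat.zero_le k)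
      have hb := hmono (Nat.succ_le_of_lt (Finset.mem_range.1 hk))
      simp only [π.left, π.right] at ha hb
      exact ⟨ha.trans_lt huk.1, huk.2.trans hb⟩
    simp [h1, hu]

lemma tendsto_eLpNorm_stepFun_sub {g : ℝ → ℂ} (hg : Continuous g) {a b : ℝ≥0}
    {π : ℕ → Subdivision a b} (hπ : Tendsto (fun n => (π n).mesh) atTop (𝓝 0)) :
    Tendsto (fun n => eLpNorm
      (fun u => stepFun g (π n) u - (Set.Ioc (a : ℝ) b).indicator g u) 2 volume) atTop (𝓝 0) := by
  rw [ENNReal.tendsto_nhds_zero]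
  intro ε hε
  -- `δ` times the `L²` norm of the indicator of `(a, b]` is below `ε`, so a uniform error `δ` is
  -- good enough.
  obtain ⟨δ, hδ, hδε⟩ := ENNReal.exists_nnreal_pos_mul_lt
    (a := volume (Set.Ioc (a : ℝ) b) ^ (1 / (2 : ℝ≥0∞).toReal)) (b := ε)
    (ENNReal.rpow_ne_top_of_nonneg (by positivity) measure_Ioc_lt_top.ne) hε.ne'
  obtain ⟨η, hη, hgη⟩ := Metric.uniformContinuousOn_iff.1
    (isCompact_Icc.uniformContinuousOn_of_continuous
      (hg.continuousOn (s := Set.Icc (a : ℝ) b))) δ (by exact_mod_cast hδ)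
  have hev : ∀ᶠ n in atTop, ((π n).mesh : ℝ) < η :=
    (NNReal.tendsto_coe.2 hπ).eventually_lt_const hη
  filter_upwards [hev] with n hn
  refine (eLpNorm_mono (norm_stepFun_sub_le (π n) hgη hn)).trans ?_
  rw [eLpNorm_indicator_const measurableSet_Ioc (by norm_num) (by norm_num)]
  simpa using hδε.le

/-- The equidistant partition of `[a, b]` into `n + 1` intervals. -/
noncomputable def uniformSubdivision {a b : ℝ≥0} (hab : a ≤ b) (n : ℕ) : Subdivision a b where
  size := n + 1
  pt k := a + k * ((b - a) / (n + 1))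
  mono i j hij := by beta_reduce; gcongr
  left := by simp
  right := by
    push_cast
    rw [mul_div_cancel₀ _ (by positivity), add_tsub_cancel_of_le hab]

lemma tendsto_mesh_uniformSubdivision {a b : ℝ≥0} (hab : a ≤ b) :
    Tendsto (fun n => (uniformSubdivision hab n).mesh) atTop (𝓝 0) := by
  have h1 : ∀ n, (uniformSubdivision hab n).mesh ≤ (b - a) * (1 / ((n : ℝ≥0) + 1)) := fun n => by
    refine Finset.sup_le fun i _ => ?_
    rw [tsub_le_iff_right]
    simp only [uniformSubdivision]
    push_cast
    apply le_of_eq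
    ring
  refine tendsto_of_tendsto_of_tendsto_of_le_of_le tendsto_const_nhds ?_ (fun _ => zero_le) h1
  simpa using (tendsto_one_div_add_atTop_nhds_zero_nat (𝕜 := ℝ≥0)).const_mul (b - a)

variable {Ω : Type*} [MeasurableSpace Ω] {P : Measure Ω}

lemma tendstoInMeasure_pi_of_tendsto_eLpNorm {d : ℕ} {Zs : ℕ → Ω → Fin d → ℂ} {Z : Ω → Fin d → ℂ}
    (hZs : ∀ n, AEStronglyMeasurable (Zs n) P) (hZ : AEStronglyMeasurable Z P)
    (h : ∀ i, Tendsto (fun n => eLpNorm (fun ω => Zs n ω i - Z ω i) 2 P) atTop (𝓝 0)) :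
    TendstoInMeasure P Zs atTop Z := by
  refine tendstoInMeasure_of_tendsto_eLpNorm (p := 2) (by norm_num) hZs hZ ?_
  have h1 : ∀ n, eLpNorm (Zs n - Z) 2 P ≤ ∑ i, eLpNorm (fun ω => Zs n ω i - Z ω i) 2 P := by
    intro n
    have hm : ∀ i, AEStronglyMeasurable (fun ω => ‖Zs n ω i - Z ω i‖) P := fun i =>
      (((continuous_apply i).comp_aestronglyMeasurable (hZs n)).sub
        ((continuous_apply i).comp_aestronglyMeasurable hZ)).norm
    have h2 : eLpNorm (Zs n - Z) 2 P ≤ eLpNorm (∑ i, fun ω => ‖Zs n ω i - Z ω i‖) 2 P := by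
      refine eLpNorm_mono_real fun ω => ?_
      rw [Finset.sum_apply]
      refine (pi_norm_le_iff_of_nonneg (by positivity)).2 fun i => ?_
      exact Finset.single_le_sum (f := fun i => ‖Zs n ω i - Z ω i‖)
        (fun _ _ => norm_nonneg _) (Finset.mem_univ i)
    refine h2.trans ((eLpNorm_sum_le (fun i _ => hm i) (by norm_num)).trans ?_)
    exact Finset.sum_le_sum fun i _ => (eLpNorm_norm _).le
  refine tendsto_of_tendsto_of_tendsto_of_le_of_le tendsto_const_nhds ?_ (fun _ => zero_le) h1
  simpa using tendsto_finsetSum (Finset.univ : Finset (Fin d)) fun i _ => h i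

variable [IsProbabilityMeasure P] {d m : ℕ} {L : ℝ≥0 → Ω → (Fin m → ℝ)}

lemma HasWienerInt.riemannSum (hL : IsLevyProcess P L) (hL2 : MemLp (L 1) 2 P)
    (f : ℝ → Matrix (Fin d) (Fin m) ℂ) {a b : ℝ≥0} (π : Subdivision a b) (i : Fin d) :
    HasWienerInt P L (fun ω => riemannSum L f π ω i)
      (fun u c => stepFun (fun x => f x i c) π u) := by
  have h := HasWienerInt.sum (P := P) (L := L) (Finset.range π.size) fun k _ =>
    HasWienerInt.sum Finset.univ fun c _ =>
      (HasWienerInt.increment hL hL2 (π.mono k.le_succ) c).const_mul (f (π.pt k) i c)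
  convert h using 1
  · ext ω
    simp [MCARMA.riemannSum, Matrix.mulVec, dotProduct]
  · ext u c
    refine Finset.sum_congr rfl fun k _ => ?_
    rw [Finset.sum_eq_single c]
    · by_cases hu : u ∈ Set.Ioc (π.pt k : ℝ) (π.pt (k + 1)) <;> simp [hu]
    · intro c' _ hc
      simp [Pi.single_eq_of_ne hc.symm]
    · simp

/-- The components of the stochastic integral of a continuous function are Wiener integrals. -/
theorem hasWienerInt_stochInt (hL : IsLevyProcess P L) (hL2 : MemLp (L 1) 2 P)
    (hL0 : ∫ ω, L 1 ω ∂P = 0) {f : ℝ → Matrix (Fin d) (Fin m) ℂ}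
    (hf : ∀ i c, Continuous fun u => f u i c) {a b : ℝ≥0} (hab : a ≤ b) (i : Fin d) :
    HasWienerInt P L (fun ω => stochInt P L f a b ω i)
      (fun u c => (Set.Ioc (a : ℝ) b).indicator (fun u => f u i c) u) := by
  have hmem : ∀ i c, MemLp (fun u => (Set.Ioc (a : ℝ) b).indicator (fun u => f u i c) u) 2
      (volume : Measure ℝ) := fun i c => by
    rw [memLp_indicator_iff_restrict measurableSet_Ioc]
    obtain ⟨C, hC⟩ := (isCompact_Icc (a := (a : ℝ)) (b := b)).exists_bound_of_continuousOn
      (hf i c).continuousOn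
    exact MemLp.of_bound (hf i c).aestronglyMeasurable C <|
      (ae_restrict_iff' measurableSet_Ioc).2 <| .of_forall fun u hu => hC u ⟨hu.1.le, hu.2⟩
  -- The Riemann sums are Wiener integrals of step functions that converge in `L²` to `1_{(a,b]} f`;
  -- equidistant partitions produce a candidate `z` for the limit.
  have hex := fun i => HasWienerInt.exists_of_tendsto hL hL2 hL0
    (fun n => HasWienerInt.riemannSum hL hL2 f (uniformSubdivision hab n) i) (hmem i)
    (fun c => tendsto_eLpNorm_stepFun_sub (hf i c) (tendsto_mesh_uniformSubdivision hab))
  choose z hz using hex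
  have hZ : IsStochInt P L f a b (fun ω i => z i ω) := by
    have hm : AEStronglyMeasurable (fun ω i => z i ω) P :=
      (memLp_pi_iff.2 fun i => (hz i).memLp).aestronglyMeasurable
    refine ⟨hm.aemeasurable, fun π hπ => tendstoInMeasure_pi_of_tendsto_eLpNorm (fun n => ?_) hm
      fun i => HasWienerInt.tendsto_eLpNorm hL hL2 hL0
        (fun n => HasWienerInt.riemannSum hL hL2 f (π n) i) (hz i)
        fun c => tendsto_eLpNorm_stepFun_sub (hf i c) hπ⟩
    exact (memLp_pi_iff.2 fun i =>
      (HasWienerInt.riemannSum hL hL2 f (π n) i).memLp).aestronglyMeasurable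
  have hex : ∃ Z, IsStochInt P L f a b Z := ⟨_, hZ⟩
  have hs : IsStochInt P L f a b (stochInt P L f a b) := by
    rw [stochInt, dif_pos hex]
    exact hex.choose_spec
  -- `stochInt` is an arbitrary choice among limits; uniqueness of limits in measure identifies it
  -- with `z` almost surely.
  have hae := tendstoInMeasure_ae_unique (hZ.2 _ (tendsto_mesh_uniformSubdivision hab))
    (hs.2 _ (tendsto_mesh_uniformSubdivision hab))
  refine (hz i).congr ?_
  filter_upwards [hae] with ω hω
  exact congrFun hω i

/-! ### Matrix exponentials and the autoregressive polynomial of the sampled process -/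

lemma mexp_zero {d : ℕ} (R : Matrix (Fin d) (Fin d) ℂ) : mexp 0 R = 1 := by
  simp [mexp]

lemma mexp_add {d : ℕ} (s t : ℝ) (R : Matrix (Fin d) (Fin d) ℂ) :
    mexp (s + t) R = mexp s R * mexp t R := by
  rw [mexp, Complex.ofReal_add, add_smul, Matrix.exp_add_of_commute]
  · rfl
  · exact ((Commute.refl R).smul_left _).smul_right _

lemma mexp_pow {d : ℕ} (t : ℝ) (R : Matrix (Fin d) (Fin d) ℂ) (n : ℕ) :
    mexp t R ^ n = mexp (n * t) R := by
  induction n with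
  | zero => simp [mexp_zero]
  | succ n ih => rw [pow_succ, ih, ← mexp_add]; push_cast; ring_nf

lemma isUnit_mexp {d : ℕ} (t : ℝ) (R : Matrix (Fin d) (Fin d) ℂ) : IsUnit (mexp t R) :=
  Matrix.isUnit_exp _

lemma mexp_conjTranspose {d : ℕ} (t : ℝ) (R : Matrix (Fin d) (Fin d) ℂ) :
    mexp t R.conjTranspose = (mexp t R).conjTranspose := by
  rw [mexp, mexp, ← Matrix.exp_conjTranspose, Matrix.conjTranspose_smul]
  simp

lemma continuous_mexp {d : ℕ} (R : Matrix (Fin d) (Fin d) ℂ) : Continuous fun t => mexp t R := by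
  let : NormedRing (Matrix (Fin d) (Fin d) ℂ) := Matrix.linftyOpNormedRing
  let : NormedAlgebra ℂ (Matrix (Fin d) (Fin d) ℂ) := Matrix.linftyOpNormedAlgebra
  let : NormedAlgebra ℚ (Matrix (Fin d) (Fin d) ℂ) := NormedAlgebra.restrictScalars ℚ ℂ _
  have h : Continuous (NormedSpace.exp : Matrix (Fin d) (Fin d) ℂ → _) := NormedSpace.exp_continuous
  unfold mexp
  exact h.comp (by fun_prop)

/-! ### The monic matrix polynomial with prescribed right solvents -/

section Psi

variable {d p : ℕ} {S : Fin p → Matrix (Fin d) (Fin d) ℂ}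

lemma psi_zero : psi S 0 = 1 := by simp [psi]

lemma psi_sub (i : Fin p) (a b : Fin d) :
    psi S (p - i) a b = (-(powerRow S * (blockVandermonde S)⁻¹)) a (i, b) := by
  have hi := i.2
  have h1 : p - (p - (i : ℕ)) = i := by omega
  have h2 : p - (p - (i : ℕ)) < p := by omega
  rw [psi, if_neg (by omega), dif_pos h2, Matrix.of_apply]
  rw [show (⟨p - (p - (i : ℕ)), h2⟩ : Fin p) = i from Fin.ext h1]

/-- The matrices `S₁, …, S_p` are right solvents of `λᵖ + Ψ₁ λᵖ⁻¹ + ⋯ + Ψ_p`. -/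
lemma sum_psi_mul_pow (hV : IsUnit (blockVandermonde S)) (k : Fin p) :
    ∑ i ∈ Finset.range (p + 1), psi S (p - i) * S k ^ i = 0 := by
  rw [Finset.sum_range_succ, Nat.sub_self, psi_zero, one_mul, Finset.sum_range]
  -- Multiplying the defining row by `V` gives, in block column `k`, the solvent equation for `S k`.
  have h1 : -(powerRow S * (blockVandermonde S)⁻¹) * blockVandermonde S = -powerRow S := by
    rw [Matrix.neg_mul, Matrix.mul_assoc,
      Matrix.nonsing_inv_mul _ ((Matrix.isUnit_iff_isUnit_det _).1 hV), Matrix.mul_one]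
  ext a b
  have h2 := congrFun (congrFun h1 a) (k, b)
  rw [Matrix.mul_apply, Fintype.sum_prod_type] at h2
  simp only [← psi_sub] at h2
  rw [Matrix.add_apply, Matrix.sum_apply, Matrix.zero_apply]
  simp only [Matrix.mul_apply]
  simp only [blockVandermonde, powerRow, Matrix.of_apply, Matrix.neg_apply] at h2
  rw [h2]
  ring

/-- If `v Ψ_p = 0`, the solvent equations multiplied by `v` lose their constant term, and the
invertible `S k` cancels. The row with blocks `v Ψ_{p-1-i}` then annihilates `V`, so it is zero; its
last block is `v Ψ₀ = v`. -/
lemma isUnit_psi (hV : IsUnit (blockVandermonde S)) (hS : ∀ k, IsUnit (S k)) :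
    IsUnit (psi S p) := by
  rcases Nat.eq_zero_or_pos p with rfl | hp
  · rw [psi_zero]; exact isUnit_one
  rw [Matrix.isUnit_iff_isUnit_det, isUnit_iff_ne_zero]
  intro hdet
  obtain ⟨v, hv, hv0⟩ := Matrix.exists_vecMul_eq_zero_iff.2 hdet
  let w : Fin p × Fin d → ℂ := fun x => Matrix.vecMul v (psi S (p - 1 - x.1)) x.2
  have h1 : ∀ k, ∑ i ∈ Finset.range p, Matrix.vecMul v (psi S (p - 1 - i) * S k ^ i) = 0 := by
    intro k
    have h2 := congrArg (Matrix.vecMul v) (sum_psi_mul_pow hV k)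
    rw [Finset.sum_range_succ', Nat.sub_zero, pow_zero, mul_one, Matrix.vecMul_add, hv0, add_zero,
      Matrix.vecMul_zero] at h2
    have h3 : ∑ i ∈ Finset.range p, psi S (p - (i + 1)) * S k ^ (i + 1) =
        (∑ i ∈ Finset.range p, psi S (p - 1 - i) * S k ^ i) * S k := by
      rw [Finset.sum_mul]
      refine Finset.sum_congr rfl fun i _ => ?_
      rw [pow_succ, mul_assoc, Nat.sub_sub, Nat.add_comm 1 i]
    rw [h3, ← Matrix.vecMul_vecMul] at h2
    have h4 := congrArg (fun x => Matrix.vecMul x (S k)⁻¹) h2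
    simp only [Matrix.vecMul_vecMul, Matrix.zero_vecMul] at h4
    rw [Matrix.mul_assoc, Matrix.mul_nonsing_inv _ ((Matrix.isUnit_iff_isUnit_det _).1 (hS k)),
      Matrix.mul_one] at h4
    rw [← h4]
    ext b
    simp [Matrix.vecMul, dotProduct, Matrix.sum_apply, Finset.mul_sum]
    exact Finset.sum_comm
  have hw : Matrix.vecMul w (blockVandermonde S) = 0 := by
    ext ⟨k, b⟩
    have h2 := congrFun (h1 k) b
    rw [Finset.sum_apply, Finset.sum_range] at h2
    rw [Pi.zero_apply] at h2 ⊢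
    rw [← h2, Matrix.vecMul, dotProduct, Fintype.sum_prod_type]
    refine Finset.sum_congr rfl fun i _ => ?_
    rw [← Matrix.vecMul_vecMul]
    rfl
  have hw0 : w = 0 := by
    by_contra hne
    exact ((Matrix.isUnit_iff_isUnit_det _).1 hV).ne_zero
      (Matrix.exists_vecMul_eq_zero_iff.1 ⟨w, hne, hw⟩)
  apply hv
  ext b
  have h5 := congrFun hw0 (⟨p - 1, by omega⟩, b)
  simpa [w, psi_zero] using h5

end Psi

/-- `∑_j Φ_j e^{-j h R_k} = I`. -/
lemma sum_phi_mul_mexp {d p : ℕ} {h : ℝ} {R : Fin p → Matrix (Fin d) (Fin d) ℂ}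
    (hV : IsUnit (blockVandermonde fun k => mexp (-h) (R k))) (k : Fin p) :
    ∑ j ∈ Finset.Icc 1 p, phi h R j * mexp (-(j * h)) (R k) = 1 := by
  have h1 := sum_psi_mul_pow hV k
  have hu := isUnit_psi hV fun k => isUnit_mexp _ _
  rw [Finset.sum_range_succ', Nat.sub_zero, pow_zero, mul_one] at h1
  -- The constant term `Ψ_p` is isolated; multiplying by `-Ψ_p⁻¹` on the left turns the solvent
  -- equation into the claim.
  have h2 := eq_neg_of_add_eq_zero_left h1
  have h3 : ∑ j ∈ Finset.Icc 1 p, phi h R j * mexp (-(j * h)) (R k) =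
      ∑ i ∈ Finset.range p, phi h R (i + 1) * mexp (-((i + 1 : ℕ) * h)) (R k) := by
    rw [Finset.range_eq_Ico, Finset.sum_Ico_add' (fun j => phi h R j * mexp (-(j * h)) (R k)) 0 p 1,
      zero_add, Finset.Ico_add_one_right_eq_Icc]
  have h4 : ∀ i : ℕ, phi h R i * mexp (-(i * h)) (R k) =
      -(psi (fun k => mexp (-h) (R k)) p)⁻¹ *
        (psi (fun k => mexp (-h) (R k)) (p - i) * mexp (-h) (R k) ^ i) := fun i => by
    rw [mexp_pow, phi, mul_neg, Matrix.neg_mul, Matrix.neg_mul, Matrix.mul_assoc]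
  rw [h3]
  simp only [h4]
  rw [← Finset.mul_sum, h2, neg_mul_neg,
    Matrix.nonsing_inv_mul _ ((Matrix.isUnit_iff_isUnit_det _).1 hu)]

/-- The filter annihilates `e^{tR_k}`. This is used twice: to remove the initial values and to
truncate the kernel. -/
lemma mexp_sub_sum_phi_mul_mexp {d p : ℕ} {h : ℝ} {R : Fin p → Matrix (Fin d) (Fin d) ℂ}
    (hV : IsUnit (blockVandermonde fun k => mexp (-h) (R k))) (k : Fin p) (s : ℝ) :
    mexp s (R k) - ∑ j ∈ Finset.Icc 1 p, phi h R j * mexp (s - j * h) (R k) = 0 := by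
  have h1 : ∀ j : ℕ, phi h R j * mexp (s - j * h) (R k) =
      phi h R j * mexp (-(j * h)) (R k) * mexp s (R k) := fun j => by
    rw [mul_assoc, ← mexp_add]; ring_nf
  simp only [h1]
  rw [← Finset.sum_mul, sum_phi_mul_mexp hV, one_mul, sub_self]

/-! ### The noise of the sampled process as a Wiener integral -/

section Kernel

variable {d m p : ℕ}

/-- The kernel of the Ornstein–Uhlenbeck process at time `t`: `1_{(0, t]}(u) e^{(t-u)R} G`. -/
noncomputable def ouKernel (R : Matrix (Fin d) (Fin d) ℂ) (G : Matrix (Fin d) (Fin m) ℂ)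
    (t u : ℝ) : Matrix (Fin d) (Fin m) ℂ :=
  (Set.Ioc 0 t).indicator (fun u => mexp (t - u) R * G) u

/-- The integrand of the noise `U_n`. -/
noncomputable def noiseKernel (h : ℝ) (R : Fin p → Matrix (Fin d) (Fin d) ℂ)
    (G : Fin p → Matrix (Fin d) (Fin m) ℂ) (n : ℕ) (u : ℝ) : Matrix (Fin d) (Fin m) ℂ :=
  (∑ k, ouKernel (R k) (G k) (n * h) u) -
    ∑ j ∈ Finset.Icc 1 p, phi h R j * ∑ k, ouKernel (R k) (G k) ((n - j : ℕ) * h) u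

variable {h : ℝ} {R : Fin p → Matrix (Fin d) (Fin d) ℂ} {G : Fin p → Matrix (Fin d) (Fin m) ℂ}
  {n r : ℕ} {u : ℝ}

lemma noiseKernel_of_notMem (hh : 0 ≤ h) (hu : u ∉ Set.Ioc 0 (n * h)) :
    noiseKernel h R G n u = 0 := by
  have h1 : ∀ j k, ouKernel (R k) (G k) ((n - j : ℕ) * h) u = 0 := fun j k => by
    refine Set.indicator_of_notMem (fun hu' => hu ⟨hu'.1, hu'.2.trans ?_⟩) _
    gcongr
    exact Nat.sub_le _ _
  have h2 := h1 0
  rw [Nat.sub_zero] at h2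
  simp [noiseKernel, h1, h2]

lemma ouKernel_of_mem {k : Fin p} {t : ℝ} (hu : u ∈ Set.Ioc 0 t) :
    ouKernel (R k) (G k) t u = mexp (t - u) (R k) * G k :=
  Set.indicator_of_mem hu _

lemma mem_Ioc_of_mem (hh : 0 ≤ h) (hr : r < n)
    (hu : u ∈ Set.Ioc (((n : ℝ) - r - 1) * h) (((n : ℝ) - r) * h)) {j : ℕ} (hj : j ≤ r) :
    u ∈ Set.Ioc 0 ((n - j : ℕ) * h) := by
  have h1 : (r : ℝ) + 1 ≤ n := by exact_mod_cast hr
  have h2 : (j : ℝ) ≤ r := by exact_mod_cast hj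
  refine ⟨lt_of_le_of_lt (mul_nonneg (by linarith) hh) hu.1, hu.2.trans ?_⟩
  rw [Nat.cast_sub (hj.trans hr.le)]
  gcongr

/-- Lags `j > r` sample at or before the left end of this interval and contribute nothing. The lags
`j ≤ r` share the right factor `e^{((n-r)h-u)R_k} G_k`, and `coeff` collects what stands to its
left. -/
lemma noiseKernel_of_lt (hh : 0 ≤ h) (hn : p ≤ n) (hr : r < p)
    (hu : u ∈ Set.Ioc (((n : ℝ) - r - 1) * h) (((n : ℝ) - r) * h)) :
    noiseKernel h R G n u = ∑ k, coeff h R r k * mexp (((n : ℝ) - r) * h - u) (R k) * G k := by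
  have hrn := hr.trans_le hn
  have h1 : ∑ j ∈ Finset.Icc 1 p, phi h R j * ∑ k, ouKernel (R k) (G k) ((n - j : ℕ) * h) u =
      ∑ j ∈ Finset.Icc 1 r, phi h R j * ∑ k, mexp ((n - j : ℕ) * h - u) (R k) * G k := by
    rw [← Finset.sum_subset (Finset.Icc_subset_Icc_right hr.le)]
    · refine Finset.sum_congr rfl fun j hj => ?_
      simp only [ouKernel_of_mem (mem_Ioc_of_mem hh hrn hu (Finset.mem_Icc.1 hj).2)]
    · intro j hj hj'
      have hj1 := Finset.mem_Icc.1 hj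
      have hj2 : r + 1 ≤ j := by
        by_contra hc
        exact hj' (Finset.mem_Icc.2 ⟨hj1.1, by omega⟩)
      have h3 : ∀ k, ouKernel (R k) (G k) ((n - j : ℕ) * h) u = 0 := fun k => by
        refine Set.indicator_of_notMem (fun hu' => (hu'.2.trans ?_).not_gt hu.1) _
        have h4 : (r : ℝ) + 1 ≤ j := by exact_mod_cast hj2
        rw [Nat.cast_sub (hj1.2.trans hn)]
        exact mul_le_mul_of_nonneg_right (by linarith) hh
      simp [h3]
  have h0 := mem_Ioc_of_mem hh hrn hu (Nat.zero_le r)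
  rw [Nat.sub_zero] at h0
  rw [noiseKernel, h1]
  simp only [ouKernel_of_mem h0, Matrix.mul_sum]
  rw [Finset.sum_comm, ← Finset.sum_sub_distrib]
  refine Finset.sum_congr rfl fun k _ => ?_
  rw [coeff, Matrix.sub_mul, Matrix.sub_mul, ← mexp_add, Matrix.sum_mul, Matrix.sum_mul]
  congr 1
  · congr 2; ring
  · refine Finset.sum_congr rfl fun j hj => ?_
    rw [Nat.cast_sub ((Finset.mem_Icc.1 hj).2.trans hrn.le), Matrix.mul_assoc (phi h R j),
      ← mexp_add, Matrix.mul_assoc]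
    congr 3; ring

/-- Here every lag `0, …, p` is active, so the complete filter acts on the exponential and gives
zero. -/
lemma noiseKernel_of_ge (hV : IsUnit (blockVandermonde fun k => mexp (-h) (R k))) (hh : 0 ≤ h)
    (hr : p ≤ r) (hrn : r < n)
    (hu : u ∈ Set.Ioc (((n : ℝ) - r - 1) * h) (((n : ℝ) - r) * h)) :
    noiseKernel h R G n u = 0 := by
  have h1 : ∑ j ∈ Finset.Icc 1 p, phi h R j * ∑ k, ouKernel (R k) (G k) ((n - j : ℕ) * h) u =
      ∑ j ∈ Finset.Icc 1 p, phi h R j * ∑ k, mexp (n * h - u - j * h) (R k) * G k := by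
    refine Finset.sum_congr rfl fun j hj => ?_
    have hj' := (Finset.mem_Icc.1 hj).2.trans hr
    simp only [ouKernel_of_mem (mem_Ioc_of_mem hh hrn hu hj')]
    rw [Nat.cast_sub (hj'.trans hrn.le)]
    ring_nf
  have h0 := mem_Ioc_of_mem hh hrn hu (Nat.zero_le r)
  rw [Nat.sub_zero] at h0
  rw [noiseKernel, h1]
  simp only [ouKernel_of_mem h0, Matrix.mul_sum]
  rw [Finset.sum_comm, ← Finset.sum_sub_distrib]
  refine Finset.sum_eq_zero fun k _ => ?_
  simp only [← Matrix.mul_assoc]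
  rw [← Matrix.sum_mul, ← Matrix.sub_mul, mexp_sub_sum_phi_mul_mexp hV, Matrix.zero_mul]

end Kernel

section Cov

variable {Ω : Type*} [MeasurableSpace Ω] {P : Measure Ω} {d m p : ℕ} {L : ℝ≥0 → Ω → (Fin m → ℝ)}
  {R : Fin p → Matrix (Fin d) (Fin d) ℂ} {G : Fin p → Matrix (Fin d) (Fin m) ℂ}
  {Y : Fin p → ℝ≥0 → Ω → (Fin d → ℂ)} {h : ℝ≥0}

/-- The initial values enter `Y` through `e^{nhR_k} Y_k(0)`, which the filter kills; `p ≤ n` makes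
all sampling times `(n-j)h` genuine. Hence no moments of `Y_k(0)` are needed. -/
lemma noise_ae_eq (hY : IsOUFamily P L R G Y)
    (hV : IsUnit (blockVandermonde fun k => mexp (-(h : ℝ)) (R k))) {n : ℕ} (hn : p ≤ n) :
    noise h R Y n =ᵐ[P] noise h R (fun k t =>
      stochInt P L (fun u => mexp (t - u) (R k) * G k) 0 t) n := by
  have hae : ∀ᵐ ω ∂P, ∀ k, ∀ i : ℕ, Y k (i * h) ω =
      (mexp ((i * h : ℝ≥0) : ℝ) (R k)).mulVec (Y k 0 ω) + stochInt P L
        (fun u => mexp (((i * h : ℝ≥0) : ℝ) - u) (R k) * G k) 0 (i * h) ω :=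
    ae_all_iff.2 fun k => ae_all_iff.2 fun i => hY.eq k (i * h)
  filter_upwards [hae] with ω hω
  simp only [noise, hω, Finset.sum_add_distrib, Matrix.mulVec_add]
  have h1 : ∑ k, (mexp ((n * h : ℝ≥0) : ℝ) (R k)).mulVec (Y k 0 ω) =
      ∑ j ∈ Finset.Icc 1 p, (phi h R j).mulVec
        (∑ k, (mexp (((n - j : ℕ) * h : ℝ≥0) : ℝ) (R k)).mulVec (Y k 0 ω)) := by
    simp only [Matrix.mulVec_sum, Matrix.mulVec_mulVec]
    rw [Finset.sum_comm]
    refine Finset.sum_congr rfl fun k _ => ?_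
    rw [← Matrix.sum_mulVec]
    congr 1
    have h2 := mexp_sub_sum_phi_mul_mexp hV k (n * h)
    rw [sub_eq_zero] at h2
    simp only [NNReal.coe_mul, NNReal.coe_natCast]
    rw [h2]
    refine Finset.sum_congr rfl fun j hj => ?_
    rw [Nat.cast_sub ((Finset.mem_Icc.1 hj).2.trans hn), sub_mul]
  rw [h1]
  abel

variable [IsProbabilityMeasure P]

lemma hasWienerInt_ou (hL : IsLevyProcess P L) (hL2 : MemLp (L 1) 2 P)
    (hL0 : ∫ ω, L 1 ω ∂P = 0) (R : Matrix (Fin d) (Fin d) ℂ) (G : Matrix (Fin d) (Fin m) ℂ)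
    (t : ℝ≥0) (i : Fin d) :
    HasWienerInt P L (fun ω => stochInt P L (fun u => mexp (t - u) R * G) 0 t ω i)
      (fun u c => ouKernel R G t u i c) := by
  have h1 : Continuous fun u => mexp (t - u) R * G :=
    ((continuous_mexp R).comp (continuous_const.sub continuous_id)).matrix_mul continuous_const
  convert hasWienerInt_stochInt hL hL2 hL0 (fun i c => h1.matrix_elem i c) (zero_le (a := t)) i
    using 3 with u c
  by_cases hu : u ∈ Set.Ioc (0 : ℝ) t <;> simp [ouKernel, hu]

/-- The covariance of two Wiener integrals. -/
lemma cov_eq_integral (hL : IsLevyProcess P L) (hL2 : MemLp (L 1) 2 P)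
    (hL0 : ∫ ω, L 1 ω ∂P = 0) {Z Z' : Ω → Fin d → ℂ} {F F' : ℝ → Matrix (Fin d) (Fin m) ℂ}
    (hZ : ∀ i, HasWienerInt P L (fun ω => Z ω i) (fun u c => F u i c))
    (hZ' : ∀ i, HasWienerInt P L (fun ω => Z' ω i) (fun u c => F' u i c)) (a b : Fin d) :
    Integrable (fun u => (F u * covL P L * (F' u).conjTranspose) a b) ∧
      cov P Z Z' a b = ∫ u, (F u * covL P L * (F' u).conjTranspose) a b := by
  have h1 : ∀ u, (F u * covL P L * (F' u).conjTranspose) a b =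
      ∑ c, ∑ c', covL P L c c' * (F u a c * star (F' u b c')) := fun u => by
    simp only [Matrix.mul_apply, Matrix.conjTranspose_apply, Finset.sum_mul]
    rw [Finset.sum_comm]
    exact Finset.sum_congr rfl fun _ _ => Finset.sum_congr rfl fun _ _ => by ring
  have h2 : ∀ c c', Integrable fun u => covL P L c c' * (F u a c * star (F' u b c')) :=
    fun c c' => by
      obtain ⟨-, hφ, -⟩ := hZ a
      obtain ⟨-, hφ', -⟩ := hZ' b
      exact ((hφ c).integrable_mul (hφ' c').star).const_mul _
  simp only [h1]
  refine ⟨integrable_finsetSum _ fun c _ => integrable_finsetSum _ fun c' _ => h2 c c', ?_⟩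
  rw [integral_finsetSum _ fun c _ => integrable_finsetSum _ fun c' _ => h2 c c']
  simp only [integral_finsetSum _ fun c' _ => h2 _ c', integral_const_mul]
  rw [← (hZ a).integral_mul_star hL hL2 hL0 (hZ' b)]
  simp only [cov, Matrix.of_apply, (hZ _).integral_eq_zero hL hL2 hL0,
    (hZ' _).integral_eq_zero hL hL2 hL0, sub_zero]

lemma hasWienerInt_noise (hL : IsLevyProcess P L) (hL2 : MemLp (L 1) 2 P)
    (hL0 : ∫ ω, L 1 ω ∂P = 0) (hY : IsOUFamily P L R G Y)
    (hV : IsUnit (blockVandermonde fun k => mexp (-(h : ℝ)) (R k))) {n : ℕ} (hn : p ≤ n)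
    (i : Fin d) :
    HasWienerInt P L (fun ω => noise h R Y n ω i) (fun u c => noiseKernel h R G n u i c) := by
  have h1 : HasWienerInt P L
      (fun ω => noise h R (fun k t => stochInt P L (fun u => mexp (t - u) (R k) * G k) 0 t) n ω i)
      (fun u c => noiseKernel h R G n u i c) := by
    have h2 := fun (n : ℕ) i => HasWienerInt.sum Finset.univ fun k _ =>
      hasWienerInt_ou hL hL2 hL0 (R k) (G k) (n * h) i
    convert (h2 n i).sub (HasWienerInt.sum (Finset.Icc 1 p) fun j _ =>
      HasWienerInt.sum Finset.univ fun i' _ => (h2 (n - j) i').const_mul (phi h R j i i')) using 1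
    · ext ω
      simp [noise, Matrix.mulVec, dotProduct]
    · ext u c
      simp [noiseKernel, Matrix.mul_apply, Matrix.sum_apply, -Nat.cast_tsub]
  refine h1.congr ?_
  filter_upwards [noise_ae_eq hY hV hn] with ω hω
  rw [hω]

end Cov

/-! ### The covariances -/

section Integrals

variable {d m p : ℕ}

/-- The integrand `e^{uR_ν} G_ν Σ G_μᴴ e^{uR_μᴴ}` of `sigmaH`. -/
noncomputable def sigmaKernel (SL : Matrix (Fin m) (Fin m) ℂ)
    (R : Fin p → Matrix (Fin d) (Fin d) ℂ) (G : Fin p → Matrix (Fin d) (Fin m) ℂ)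
    (ν μ : Fin p) (u : ℝ) : Matrix (Fin d) (Fin d) ℂ :=
  mexp u (R ν) * G ν * SL * (G μ).conjTranspose * (mexp u (R μ)).conjTranspose

variable {SL : Matrix (Fin m) (Fin m) ℂ} {R : Fin p → Matrix (Fin d) (Fin d) ℂ}
  {G : Fin p → Matrix (Fin d) (Fin m) ℂ}

lemma continuous_sigmaKernel (ν μ : Fin p) : Continuous (sigmaKernel SL R G ν μ) :=
  ((((continuous_mexp (R ν)).matrix_mul continuous_const).matrix_mul continuous_const).matrix_mul
    continuous_const).matrix_mul (continuous_mexp (R μ)).matrix_conjTranspose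

lemma mul_mul_conjTranspose_eq_sum {h t : ℝ} {r s : ℕ} (u : ℝ) :
    (∑ k, coeff h R s k * mexp (t - u) (R k) * G k) * SL *
      (∑ k, coeff h R r k * mexp (t - u) (R k) * G k).conjTranspose =
    ∑ ν, ∑ μ, coeff h R s ν * sigmaKernel SL R G ν μ (t - u) * (coeff h R r μ).conjTranspose := by
  rw [Matrix.conjTranspose_sum, Matrix.sum_mul, Matrix.sum_mul]
  refine Finset.sum_congr rfl fun ν _ => ?_
  rw [Matrix.mul_sum]
  refine Finset.sum_congr rfl fun μ _ => ?_
  simp only [sigmaKernel, Matrix.conjTranspose_mul, Matrix.mul_assoc]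

/-- Entrywise integration commutes with multiplication by constant matrices. -/
lemma integral_mul_mul_apply {K : ℝ → Matrix (Fin d) (Fin d) ℂ} (hK : Continuous K)
    (C D : Matrix (Fin d) (Fin d) ℂ) (x y : ℝ) (a b : Fin d) :
    ∫ u in x..y, (C * K u * D) a b = (C * Matrix.of (fun i j => ∫ u in x..y, K u i j) * D) a b := by
  have hi : ∀ i j, Continuous fun u => C a j * K u j i * D i b := fun i j =>
    (continuous_const.mul (hK.matrix_elem j i)).mul continuous_const
  simp only [Matrix.mul_apply, Finset.sum_mul, Matrix.of_apply]
  rw [intervalIntegral.integral_finsetSum fun i _ =>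
    (continuous_finsetSum _ fun j _ => hi i j).intervalIntegrable _ _]
  refine Finset.sum_congr rfl fun i _ => ?_
  rw [intervalIntegral.integral_finsetSum fun j _ => (hi i j).intervalIntegrable _ _]
  refine Finset.sum_congr rfl fun j _ => ?_
  rw [intervalIntegral.integral_mul_const, intervalIntegral.integral_const_mul]

/-- The substitution `u ↦ t - u` removes `t`, so every sampling interval yields the same matrix. -/
lemma of_integral_sigmaKernel (h t : ℝ) (ν μ : Fin p) :
    (Matrix.of fun i j => ∫ u in (t - h)..t, sigmaKernel SL R G ν μ (t - u) i j) =
      sigmaH h SL R G ν μ := by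
  ext i j
  have h1 := intervalIntegral.integral_comp_sub_left (a := t - h) (b := t)
    (fun u => sigmaKernel SL R G ν μ u i j) t
  rw [sub_self, sub_sub_cancel] at h1
  simp only [sigmaH, Matrix.of_apply, mexp_conjTranspose]
  exact h1

lemma integral_sum_coeff_mul_sigmaKernel (h t : ℝ) (r s : ℕ) (a b : Fin d) :
    ∫ u in (t - h)..t, (∑ ν, ∑ μ, coeff h R s ν * sigmaKernel SL R G ν μ (t - u) *
      (coeff h R r μ).conjTranspose) a b =
    (∑ ν, ∑ μ, coeff h R s ν * sigmaH h SL R G ν μ * (coeff h R r μ).conjTranspose) a b := by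
  have hc : ∀ ν μ, Continuous fun u => sigmaKernel SL R G ν μ (t - u) := fun ν μ =>
    (continuous_sigmaKernel ν μ).comp (continuous_const.sub continuous_id)
  have hi : ∀ ν μ, Continuous fun u => (coeff h R s ν * sigmaKernel SL R G ν μ (t - u) *
      (coeff h R r μ).conjTranspose) a b := fun ν μ =>
    ((continuous_const.matrix_mul (hc ν μ)).matrix_mul continuous_const).matrix_elem a b
  simp only [Matrix.sum_apply]
  rw [intervalIntegral.integral_finsetSum fun ν _ =>
    (continuous_finsetSum _ fun μ _ => hi ν μ).intervalIntegrable _ _]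
  refine Finset.sum_congr rfl fun ν _ => ?_
  rw [intervalIntegral.integral_finsetSum fun μ _ => (hi ν μ).intervalIntegrable _ _]
  refine Finset.sum_congr rfl fun μ _ => ?_
  rw [integral_mul_mul_apply (hc ν μ), of_integral_sigmaKernel]

end Integrals

section Cov

variable {Ω : Type*} [MeasurableSpace Ω] {P : Measure Ω} [IsProbabilityMeasure P] {d m p : ℕ}
  {L : ℝ≥0 → Ω → (Fin m → ℝ)} {R : Fin p → Matrix (Fin d) (Fin d) ℂ}
  {G : Fin p → Matrix (Fin d) (Fin m) ℂ} {Y : Fin p → ℝ≥0 → Ω → (Fin d → ℂ)} {h : ℝ≥0}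

/-- The covariance of the Ornstein–Uhlenbeck noise. -/
lemma cov_ouNoise (hL : IsLevyProcess P L) (hL2 : MemLp (L 1) 2 P)
    (hL0 : ∫ ω, L 1 ω ∂P = 0) (ν μ : Fin p) :
    cov P (ouNoise P L h R G ν) (ouNoise P L h R G μ) = sigmaH h (covL P L) R G ν μ := by
  unfold ouNoise
  ext a b
  rw [(cov_eq_integral hL hL2 hL0 (fun i => hasWienerInt_ou hL hL2 hL0 (R ν) (G ν) h i)
    (fun i => hasWienerInt_ou hL hL2 hL0 (R μ) (G μ) h i) a b).2]
  have h1 : ∀ u, (ouKernel (R ν) (G ν) h u * covL P L *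
      (ouKernel (R μ) (G μ) h u).conjTranspose) a b =
      (Set.Ioc (0 : ℝ) h).indicator (fun u => sigmaKernel (covL P L) R G ν μ (h - u) a b) u := by
    intro u
    by_cases hu : u ∈ Set.Ioc (0 : ℝ) h
    · rw [ouKernel_of_mem hu, ouKernel_of_mem hu, Set.indicator_of_mem hu]
      simp only [sigmaKernel, Matrix.conjTranspose_mul, Matrix.mul_assoc]
    · simp [ouKernel, hu]
  simp only [h1]
  rw [integral_indicator measurableSet_Ioc, ← of_integral_sigmaKernel (h : ℝ) h, sub_self]
  exact (intervalIntegral.integral_of_le h.2).symm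

/-- The autocovariances of the noise, for all lags at once. -/
lemma cov_noise (hL : IsLevyProcess P L) (hL2 : MemLp (L 1) 2 P)
    (hL0 : ∫ ω, L 1 ω ∂P = 0) (hY : IsOUFamily P L R G Y)
    (hV : IsUnit (blockVandermonde fun k => mexp (-(h : ℝ)) (R k))) {n : ℕ} (hn : p ≤ n) (l : ℕ) :
    cov P (noise h R Y (n + l)) (noise h R Y n) =
      ∑ r ∈ Finset.range (p - l), ∑ ν, ∑ μ,
        coeff h R (r + l) ν * sigmaH h (covL P L) R G ν μ * (coeff h R r μ).conjTranspose := by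
  ext a b
  set D : ℝ → ℂ := fun u => (noiseKernel h R G (n + l) u * covL P L *
    (noiseKernel h R G n u).conjTranspose) a b with hD
  obtain ⟨hint, hcov⟩ := cov_eq_integral hL hL2 hL0
    (hasWienerInt_noise hL hL2 hL0 hY hV (hn.trans (Nat.le_add_right n l)))
    (hasWienerInt_noise hL hL2 hL0 hY hV hn) a b
  have hh : (0 : ℝ) ≤ h := h.2
  -- The kernel of `U_n` vanishes outside `(0, nh]`, and this cuts off the longer kernel of
  -- `U_{n+l}`.
  have h1 : ∫ u, D u = ∫ u in (0 : ℝ)..n * h, D u := by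
    rw [intervalIntegral.integral_of_le (by positivity), ← integral_indicator measurableSet_Ioc]
    refine integral_congr_ae (.of_forall fun u => ?_)
    by_cases hu : u ∈ Set.Ioc (0 : ℝ) (n * h)
    · simp [hu]
    · simp [hD, hu, noiseKernel_of_notMem hh hu]
  have h2 : ∫ u in (0 : ℝ)..n * h, D u =
      ∑ r ∈ Finset.range n, ∫ u in (((n : ℝ) - r - 1) * h)..(((n : ℝ) - r) * h), D u := by
    have h3 := intervalIntegral.sum_integral_adjacent_intervals (μ := volume) (f := D)
      (a := fun k : ℕ => (k : ℝ) * h) (n := n) fun k _ => hint.intervalIntegrable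
    rw [Nat.cast_zero, zero_mul] at h3
    -- The sum is reversed so that `r` counts intervals backwards from `nh`.
    rw [← h3, ← Finset.sum_range_reflect]
    refine Finset.sum_congr rfl fun r hr => ?_
    have hr' := Finset.mem_range.1 hr
    have h4 : ((n - 1 - r : ℕ) : ℝ) = n - r - 1 := by
      rw [Nat.sub_sub, Nat.cast_sub (by omega)]; push_cast; ring
    rw [Nat.cast_add_one, h4, sub_add_cancel]
  have hIoc : ∀ r : ℕ, ∀ u ∈ Set.Ioc (((n : ℝ) - r - 1) * h) (((n : ℝ) - r) * h),
      u ∈ Set.Ioc ((((n + l : ℕ) : ℝ) - (r + l : ℕ) - 1) * h)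
        ((((n + l : ℕ) : ℝ) - (r + l : ℕ)) * h) := fun r u hu => by
    push_cast
    rwa [add_sub_add_right_eq_sub]
  have hle : ∀ r : ℕ, ((n : ℝ) - r - 1) * h ≤ ((n : ℝ) - r) * h := fun r => by
    exact mul_le_mul_of_nonneg_right (by linarith) hh
  -- Intervals with `r ≥ p - l` drop out, since `r + l ≥ p` makes the kernel of `U_{n+l}` vanish
  -- there. The subtraction is truncated, so for `l ≥ p` every interval drops.
  rw [hcov, h1, h2, Matrix.sum_apply, ← Finset.sum_subset
    (Finset.range_subset_range.2 ((Nat.sub_le p l).trans hn))]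
  · refine Finset.sum_congr rfl fun r hr => ?_
    have hr' := Finset.mem_range.1 hr
    rw [← integral_sum_coeff_mul_sigmaKernel (h : ℝ) (((n : ℝ) - r) * h),
      show ((n : ℝ) - r) * h - h = ((n : ℝ) - r - 1) * h by ring]
    rw [intervalIntegral.integral_of_le (hle r), intervalIntegral.integral_of_le (hle r)]
    refine setIntegral_congr_fun measurableSet_Ioc fun u hu => ?_
    have h5 := noiseKernel_of_lt (G := G) (R := R) hh (hn.trans (Nat.le_add_right n l))
      (show r + l < p by omega) (hIoc r u hu)
    have h6 : ((n + l : ℕ) : ℝ) - (r + l : ℕ) = n - r := by push_cast; ring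
    rw [h6] at h5
    simp only [hD]
    rw [h5, noiseKernel_of_lt hh hn (show r < p by omega) hu, mul_mul_conjTranspose_eq_sum]
  · intro r hr hr'
    rw [intervalIntegral.integral_of_le (hle r)]
    refine setIntegral_eq_zero_of_forall_eq_zero fun u hu => ?_
    have hrn := Finset.mem_range.1 hr
    have hrp := Finset.mem_range.not.1 hr'
    simp only [hD]
    rw [noiseKernel_of_ge hV hh (show p ≤ r + l by omega) (show r + l < n + l by omega)
      (hIoc r u hu)]
    simp

end Cov

end MCARMA

theorem mainTheorem5
    {Ω : Type*} [MeasurableSpace Ω] (P : Measure Ω) [IsProbabilityMeasure P]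
    (d m p q : ℕ) (hpq : q < p)
    -- the autoregressive and the moving average polynomial
    (A : ℕ → Matrix (Fin d) (Fin d) ℝ) (hA : A 0 = 1)
    (B : ℕ → Matrix (Fin d) (Fin m) ℝ)
    (hAB : MCARMA.LeftCoprime (MCARMA.lambdaMatrix p fun k => MCARMA.toC (A k))
      (MCARMA.lambdaMatrix q fun k => MCARMA.toC (B k)))
    -- the right solvents and the residues of `F = A⁻¹ B`
    (R : Fin p → Matrix (Fin d) (Fin d) ℂ)
    (hR : MCARMA.IsCompleteRegularSet (fun k => MCARMA.toC (A k)) R)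
    (Γ : Fin p → ℝ → ℂ)
    (hΓ : ∀ k, MCARMA.IsResidueContour
      (MCARMA.lambdaMatrix p fun k => MCARMA.toC (A k)) (R k) (Γ k))
    (G : Fin p → Matrix (Fin d) (Fin m) ℂ)
    (hG : ∀ k, G k = MCARMA.residue (MCARMA.lambdaMatrix p fun k => MCARMA.toC (A k))
      (MCARMA.lambdaMatrix q fun k => MCARMA.toC (B k)) (Γ k))
    -- the driving Lévy process
    (L : ℝ≥0 → Ω → (Fin m → ℝ)) (hL : MCARMA.IsLevyProcess P L)
    (hL2 : MemLp (L 1) 2 P) (hL0 : ∫ ω, L 1 ω ∂P = 0)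
    -- the Ornstein–Uhlenbeck processes whose sum is the MCARMA process
    (Y : Fin p → ℝ≥0 → Ω → (Fin d → ℂ)) (hY : MCARMA.IsOUFamily P L R G Y)
    -- the sampling distance, such that `Φ` is well defined
    (h : ℝ≥0) (hh : 0 < h)
    (hV : IsUnit (MCARMA.blockVandermonde fun k => MCARMA.mexp (-(h : ℝ)) (R k))) :
    (∀ n, p ≤ n → MemLp (MCARMA.noise h R Y n) 2 P) ∧
    (∀ ν, MemLp (MCARMA.ouNoise P L h R G ν) 2 P) ∧
    (∀ ν μ, MCARMA.cov P (MCARMA.ouNoise P L h R G ν) (MCARMA.ouNoise P L h R G μ) =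
      MCARMA.sigmaH h (MCARMA.covL P L) R G ν μ) ∧
    (∀ n, p ≤ n → ∀ l, l < p →
      MCARMA.cov P (MCARMA.noise h R Y (n + l)) (MCARMA.noise h R Y n) =
        ∑ ν, ∑ r ∈ Finset.range (p - l), ∑ μ,
          MCARMA.coeff h R (r + l) ν * MCARMA.sigmaH h (MCARMA.covL P L) R G ν μ *
            (MCARMA.coeff h R r μ).conjTranspose) ∧
    (∀ n, p ≤ n → ∀ l, p ≤ l →
      MCARMA.cov P (MCARMA.noise h R Y (n + l)) (MCARMA.noise h R Y n) = 0) := by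
  refine ⟨fun n hn => ?_, fun ν => ?_, ?_, fun n hn l hl => ?_, fun n hn l hl => ?_⟩
  · exact memLp_pi_iff.2 fun i =>
      (MCARMA.hasWienerInt_noise hL hL2 hL0 hY hV hn i).memLp
  · exact memLp_pi_iff.2 fun i =>
      (MCARMA.hasWienerInt_ou hL hL2 hL0 (R ν) (G ν) h i).memLp
  · exact MCARMA.cov_ouNoise hL hL2 hL0
  · rw [MCARMA.cov_noise hL hL2 hL0 hY hV hn l, Finset.sum_comm]
  · rw [MCARMA.cov_noise hL hL2 hL0 hY hV hn l, Nat.sub_eq_zero_of_le hl, Finset.range_zero,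
      Finset.sum_empty]
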